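/- Let $d$ be a natural number, $\mathbb B^d$ the open unit ball of $\mathbb C^d$ with $\langle z,\zeta\rangle=\sum_j z_j\overline{\zeta_j}$, and let $\mathcal U,\mathcal Y,\mathcal X$ be complex Hilbert spaces. Let $S\in\mathcal S_d(\mathcal U,\mathcal Y)$, i.e. $S:\mathbb B^d\to\mathcal L(\mathcal U,\mathcal Y)$ is such that the kernel $$K_S(z,\zeta)=\frac{I_{\mathcal Y}-S(z)S(\zeta)^*}{1-\langle z,\zeta\rangle}$$ is positive on $\mathbb B^d\times\mathbb B^d$, and let $\mathcal H(K_S)$ be the reproducing kernel Hilbert space of $\mathcal Y$-valued functions with kernel $K_S$. Let $\mathcal H_{\mathcal Y}(k_d)$ be the Drury–Arveson space, i.e. the reproducing kernel Hilbert space with kernel $I_{\mathcal Y}/(1-\langle z,\zeta\rangle)$, let $M_{z_j}$ be the operator of multiplication by $z_j$ on $\mathcal H_{\mathcal Y}(k_d)$, and let $M_{z_j}^*$ be its adjoint in $\mathcal H_{\mathcal Y}(k_d)$. Let $\mathbf T=(T_1,\dots,T_d)$ be a commuting tuple of operators on $\mathcal X$ such that the row operator $T=[T_1\ \cdots\ T_d]:\mathcal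 X^d\to\mathcal X$ is a contraction. Assume that $T$ is completely non-coisometric: there is no nonzero closed subspace $\mathcal M\subset\mathcal X$ invariant under $T_1^*,\dots,T_d^*$ for which $P_{\mathcal M}[T_1|_{\mathcal M}\ \cdots\ T_d|_{\mathcal M}]:\mathcal M^d\to\mathcal M$ is a coisometry. Put $D_T=(I-T^*T)^{1/2}$, $D_{T^*}=(I-TT^*)^{1/2}$, $\mathcal D_T=\overline{\operatorname{Ran}}\,D_T$, $\mathcal D_{T^*}=\overline{\operatorname{Ran}}\,D_{T^*}$, $Z(z)=[z_1I_{\mathcal X}\ \cdots\ z_dI_{\mathcal X}]$, and let $$\theta_T(z)=\left.\left(-T+D_{T^*}(I_{\mathcal X}-Z(z)T^*)^{-1}Z(z)D_T\right)\right|_{\mathcal D_T}:\mathcal D_T\to\mathcal D_{T^*}\qquad(z\in\mathbb B^d)$$ be the characteristic function of $T$. Assume that $S$ coincides with $\theta_T$: there are unitary operators $\alpha:\mathcal D_{T^*}\to\mathcal Y$ and $\beta:\mathcal U\to\mathcal D_T$ such that $S(z)=\alpha\,\theta_T(z)\,\beta$ for all $z\in\mathbb B^d$. Then: 1. $S$ is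 pure: if $u\in\mathcal U$ and $\|S(0)u\|=\|u\|$, then $u=0$. 2. $\mathcal H(K_S)$ is invariant under the backward shifts: every $f\in\mathcal H(K_S)$ belongs to $\mathcal H_{\mathcal Y}(k_d)$, and $M_{z_j}^*f\in\mathcal H(K_S)$ for $j=1,\dots,d$. 3. For every $f\in\mathcal H(K_S)$, $$\sum_{j=1}^d\|M_{z_j}^*f\|^2_{\mathcal H(K_S)}\le\|f\|^2_{\mathcal H(K_S)}-\|f(0)\|^2_{\mathcal Y}.$$ 4. The block column operator $$A=\begin{bmatrix}M_{z_1}^*|_{\mathcal H(K_S)}\\ \vdots\\ M_{z_d}^*|_{\mathcal H(K_S)}\end{bmatrix}:\mathcal H(K_S)\to\mathcal H(K_S)^d$$ is bounded, and $$\dim\operatorname{Ker}A^*|_{\mathcal D^\perp}=\dim\{u\in\mathcal U:\ S(z)u=0\text{ for all }z\in\mathbb B^d\},$$ where $\dim$ is the Hilbert space dimension and $\mathcal D^\perp$ is the orthogonal complement in $\mathcal H(K_S)^d$ of the closed linear span $\mathcal D$ of the vectors $(\overline{\zeta_1}K_S(\cdot,\zeta)y,\dots,\overline{\zeta_d}K_S(\cdot,\zeta)y)$,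 $\zeta\in\mathbb B^d$, $y\in\mathcal Y$. -/

import Mathlib

namespace BallModel

section Kernels

open scoped ComplexOrder InnerProductSpace

/-- The open unit ball of the Euclidean space `ℂ^d`. -/
abbrev UnitBall (d : ℕ) : Type := Metric.ball (0 : EuclideanSpace ℂ (Fin d)) 1

theorem scalarKernel_posSemidef {X V : Type*} [NormedAddCommGroup V] [InnerProductSpace ℂ V]
    [CompleteSpace V] {c : Matrix X X ℂ} (hc : c.PosSemidef) :
    (Matrix.of fun x y ↦ c x y • (1 : V →L[ℂ] V) : Matrix X X (V →L[ℂ] V)).PosSemidef := by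
  classical
  have tf := (RKHS.posSemidef_tfae (𝕜 := ℂ)
    (K := (Matrix.of fun x y ↦ c x y • (1 : V →L[ℂ] V) : Matrix X X (V →L[ℂ] V)))).out 0 2
  refine tf.2 ⟨?_, fun v ↦ ?_⟩
  · ext x y u
    have := hc.isHermitian.apply x y
    simp [Matrix.conjTranspose_apply, ← this]
  · have h1 := hc.submatrix ((↑) : v.support → X)
    have h2 := h1.hadamard (Matrix.posSemidef_gram ℂ (fun x : v.support ↦ v x))
    have h3 := h2.dotProduct_mulVec_nonneg (fun _ ↦ 1)
    have h4 := (Complex.le_def.1 h3).1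
    have key : ∀ x y : X, c x y = (starRingEnd ℂ) (c y x) := fun x y ↦ (hc.isHermitian.apply x y).symm
    simp only [Finsupp.sum, ← Finset.sum_attach v.support (fun i ↦ ∑ j ∈ v.support, _)]
    simp only [← Finset.sum_attach v.support (fun i ↦ inner ℂ _ _)]
    simpa [dotProduct, Matrix.mulVec, inner_smul_left, ← key, mul_comm] using h4

/-- The scalar kernel `k_d(z, ζ) = 1 / (1 - ⟨z, ζ⟩)`, where `⟨z, ζ⟩ = ∑ z_j conj(ζ_j)`
(Mathlib's inner product is conjugate-linear in its first argument). -/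
noncomputable def daScalar (d : ℕ) : Matrix (UnitBall d) (UnitBall d) ℂ :=
  Matrix.of fun z ζ ↦ (1 - ⟪(ζ : EuclideanSpace ℂ (Fin d)), z⟫_ℂ)⁻¹

theorem rankOne_posSemidef {X : Type*} (a : X → ℂ) :
    (Matrix.vecMulVec a (star a)).PosSemidef := by
  refine ⟨?_, fun v ↦ ?_⟩
  · ext x y
    simp [Matrix.vecMulVec, mul_comm]
  · have : (v.sum fun i xi ↦ v.sum fun j xj ↦ star xi * Matrix.vecMulVec a (star a) i j * xj)
        = star (v.sum fun i xi ↦ star (a i) * xi) * (v.sum fun i xi ↦ star (a i) * xi) := by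
      simp only [Finsupp.sum, star_sum, Finset.sum_mul_sum]
      refine Finset.sum_congr rfl fun i _ ↦ Finset.sum_congr rfl fun j _ ↦ ?_
      simp [Matrix.vecMulVec]
      ring
    rw [this]
    exact star_mul_self_nonneg _

theorem coordKernel_posSemidef (d : ℕ) (s : Finset (Fin d)) :
    (Matrix.of fun z ζ : UnitBall d ↦ ∑ j ∈ s, z.1 j * star (ζ.1 j)).PosSemidef := by
  have := Matrix.posSemidef_sum (R := ℂ) s (x := fun j ↦ Matrix.vecMulVec (fun z : UnitBall d ↦ z.1 j)
     (star fun z : UnitBall d ↦ z.1 j)) (fun j _ ↦ rankOne_posSemidef _)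
  convert this using 1
  ext z ζ
  simp [Matrix.sum_apply, Matrix.vecMulVec]

theorem onesKernel_posSemidef (d : ℕ) :
    (Matrix.of fun _ _ : UnitBall d ↦ (1 : ℂ)).PosSemidef := by
  convert rankOne_posSemidef (fun _ : UnitBall d ↦ (1 : ℂ)) using 1
  ext z ζ
  simp [Matrix.vecMulVec]

theorem innerKernel_posSemidef (d : ℕ) :
    (Matrix.of fun z ζ : UnitBall d ↦ ⟪(ζ : EuclideanSpace ℂ (Fin d)), z⟫_ℂ).PosSemidef := by
  exact coordKernel_posSemidef d Finset.univ

theorem norm_inner_lt_one {d : ℕ} (z ζ : UnitBall d) :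
    ‖⟪(ζ : EuclideanSpace ℂ (Fin d)), z⟫_ℂ‖ < 1 := by
  have hz := z.2
  have hζ := ζ.2
  rw [mem_ball_zero_iff] at hz hζ
  calc _ ≤ ‖(ζ : EuclideanSpace ℂ (Fin d))‖ * ‖(z : EuclideanSpace ℂ (Fin d))‖ := norm_inner_le_norm _ _
    _ < 1 := by nlinarith [norm_nonneg (ζ : EuclideanSpace ℂ (Fin d)), norm_nonneg (z : EuclideanSpace ℂ (Fin d))]

theorem daScalar_posSemidef (d : ℕ) : (daScalar d).PosSemidef := by
  have hpow : ∀ n : ℕ, (Matrix.of fun z ζ : UnitBall d ↦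
      ⟪(ζ : EuclideanSpace ℂ (Fin d)), z⟫_ℂ ^ n).PosSemidef := by
    intro n
    induction n with
    | zero => simpa using onesKernel_posSemidef d
    | succ n ih =>
      have e : (Matrix.of fun z ζ : UnitBall d ↦ ⟪(ζ : EuclideanSpace ℂ (Fin d)), z⟫_ℂ ^ (n + 1)) =
          Matrix.hadamard (Matrix.of fun z ζ : UnitBall d ↦
            ⟪(ζ : EuclideanSpace ℂ (Fin d)), z⟫_ℂ ^ n) (Matrix.of fun z ζ : UnitBall d ↦
            ⟪(ζ : EuclideanSpace ℂ (Fin d)), z⟫_ℂ) := by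
        ext z ζ
        simp [pow_succ]
      rw [e]
      exact ih.hadamard (innerKernel_posSemidef d)
  constructor
  · ext z ζ
    simp [daScalar, Matrix.conjTranspose_apply]
  · intro v
    have hs : HasSum (fun n : ℕ ↦ v.sum fun i xi ↦ v.sum fun j xj ↦
        star xi * (⟪(j : EuclideanSpace ℂ (Fin d)), i⟫_ℂ ^ n) * xj)
        (v.sum fun i xi ↦ v.sum fun j xj ↦ star xi * daScalar d i j * xj) := by
      refine hasSum_sum fun i _ ↦ hasSum_sum fun j _ ↦ ?_
      exact ((hasSum_geometric_of_norm_lt_one (norm_inner_lt_one i j)).mul_left _).mul_right _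
    exact hs.nonneg fun n ↦ (hpow n).2 v

theorem daScalar_mul_posSemidef (d : ℕ) (j : Fin d) :
    (Matrix.of fun z ζ : UnitBall d ↦ (1 - z.1 j * star (ζ.1 j)) * daScalar d z ζ).PosSemidef := by
  classical
  convert (onesKernel_posSemidef d).add
    ((coordKernel_posSemidef d (Finset.univ.erase j)).hadamard (daScalar_posSemidef d)) using 1
  ext z ζ
  have h0 : (1 - ⟪(ζ : EuclideanSpace ℂ (Fin d)), z⟫_ℂ) ≠ 0 := by
    intro h
    have := norm_inner_lt_one z ζ
    rw [← sub_eq_zero.1 h] at this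
    simp at this
  have h1 : ⟪(ζ : EuclideanSpace ℂ (Fin d)), z⟫_ℂ = ∑ j, z.1 j * star (ζ.1 j) := rfl
  have h2 := Finset.add_sum_erase Finset.univ (fun j ↦ z.1 j * star (ζ.1 j)) (Finset.mem_univ j)
  rw [← h1] at h2
  simp only [Matrix.of_apply, Matrix.add_apply, Matrix.hadamard_apply, daScalar]
  field_simp
  linear_combination -h2


section KernelSpace

variable {X V : Type*} [NormedAddCommGroup V] [InnerProductSpace ℂ V] [CompleteSpace V]

/-- The reproducing kernel Hilbert space `H(K)` of `V`-valued functions on `X` with the positive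
operator-valued kernel `K`. -/
def KernelSpace (K : Matrix X X (V →L[ℂ] V)) (hK : K.PosSemidef) : Type _ :=
  haveI : Fact K.PosSemidef := ⟨hK⟩
  RKHS.OfKernel K

variable (K : Matrix X X (V →L[ℂ] V)) (hK : K.PosSemidef)

noncomputable instance : NormedAddCommGroup (KernelSpace K hK) :=
  haveI : Fact K.PosSemidef := ⟨hK⟩
  inferInstanceAs (NormedAddCommGroup (RKHS.OfKernel K))

noncomputable instance : InnerProductSpace ℂ (KernelSpace K hK) :=
  haveI : Fact K.PosSemidef := ⟨hK⟩
  inferInstanceAs (InnerProductSpace ℂ (RKHS.OfKernel K))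

instance : CompleteSpace (KernelSpace K hK) :=
  haveI : Fact K.PosSemidef := ⟨hK⟩
  inferInstanceAs (CompleteSpace (RKHS.OfKernel K))

noncomputable instance : RKHS ℂ (KernelSpace K hK) X V :=
  haveI : Fact K.PosSemidef := ⟨hK⟩
  inferInstanceAs (RKHS ℂ (RKHS.OfKernel K) X V)

theorem KernelSpace.kernel_eq : RKHS.kernel (KernelSpace K hK) = K :=
  haveI : Fact K.PosSemidef := ⟨hK⟩
  RKHS.OfKernel.kernel_ofKernel (K := K)

end KernelSpace

/-- The operator-valued kernel `k_d(z, ζ) I_Y`. -/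
noncomputable def daKernel (d : ℕ) (Y : Type*) [NormedAddCommGroup Y] [InnerProductSpace ℂ Y] :
    Matrix (UnitBall d) (UnitBall d) (Y →L[ℂ] Y) :=
  Matrix.of fun z ζ ↦ daScalar d z ζ • (1 : Y →L[ℂ] Y)

section
variable (d : ℕ) (Y : Type*) [NormedAddCommGroup Y] [InnerProductSpace ℂ Y] [CompleteSpace Y]

theorem daKernel_posSemidef : (daKernel d Y).PosSemidef :=
  scalarKernel_posSemidef (daScalar_posSemidef d)

/-- The Drury-Arveson space `H_Y(k_d)` of `Y`-valued functions on the ball. -/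
abbrev DruryArveson : Type _ :=
  KernelSpace (daKernel d Y) (daKernel_posSemidef d Y)

/-- The finite sums `∑ k_d(·, z) v_z` of kernel functions. -/
noncomputable def kerSum : (UnitBall d →₀ Y) →ₗ[ℂ] DruryArveson d Y :=
  Finsupp.lsum ℂ fun z ↦ (RKHS.kerFun (DruryArveson d Y) z : Y →ₗ[ℂ] DruryArveson d Y)

/-- The finite sums `∑ conj(z_j) k_d(·, z) v_z` of kernel functions. -/
noncomputable def kerSumShift (j : Fin d) : (UnitBall d →₀ Y) →ₗ[ℂ] DruryArveson d Y :=
  Finsupp.lsum ℂ fun z ↦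
    star (z.1 j) • (RKHS.kerFun (DruryArveson d Y) z : Y →ₗ[ℂ] DruryArveson d Y)

theorem denseRange_kerSum : DenseRange (kerSum d Y) := by
  have h := RKHS.kerFun_dense (DruryArveson d Y)
  rw [← Submodule.dense_iff_topologicalClosure_eq_top] at h
  refine h.mono ?_
  have : Submodule.span ℂ {RKHS.kerFun (DruryArveson d Y) x v | (x) (v)} ≤ LinearMap.range (kerSum d Y) := by
    rw [Submodule.span_le]
    rintro _ ⟨x, v, rfl⟩
    exact ⟨Finsupp.single x v, by simp [kerSum]⟩
  exact this

theorem norm_kerSumShift_le (j : Fin d) (v : UnitBall d →₀ Y) :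
    ‖kerSumShift d Y j v‖ ≤ 1 * ‖kerSum d Y v‖ := by
  have tf := (RKHS.posSemidef_tfae (𝕜 := ℂ)
    (K := Matrix.of fun x y ↦ ((Matrix.of fun z ζ : UnitBall d ↦
      (1 - z.1 j * star (ζ.1 j)) * daScalar d z ζ) x y) • (1 : Y →L[ℂ] Y))).out 0 2
  have h := (tf.1 (scalarKernel_posSemidef (V := Y) (daScalar_mul_posSemidef d j))).2 v
  have hker : ∀ (z ζ : UnitBall d) (u w : Y), ⟪RKHS.kerFun (DruryArveson d Y) z u, RKHS.kerFun (DruryArveson d Y) ζ w⟫_ℂ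
      = ⟪daScalar d ζ z • u, w⟫_ℂ := by
    intro z ζ u w
    rw [← RKHS.kernel_inner, KernelSpace.kernel_eq]
    rfl
  have h1 : ⟪kerSum d Y v, kerSum d Y v⟫_ℂ - ⟪kerSumShift d Y j v, kerSumShift d Y j v⟫_ℂ =
      v.sum fun x w ↦ v.sum fun x' w' ↦
        ⟪(Matrix.of fun x y ↦ ((Matrix.of fun z ζ : UnitBall d ↦
          (1 - z.1 j * star (ζ.1 j)) * daScalar d z ζ) x y) • (1 : Y →L[ℂ] Y)) x' x w, w'⟫_ℂ := by
    simp only [kerSum, kerSumShift, Finsupp.lsum_apply, Finsupp.sum, sum_inner, inner_sum,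
      ← Finset.sum_sub_distrib]
    conv_rhs => rw [Finset.sum_comm]
    refine Finset.sum_congr rfl fun x _ ↦ Finset.sum_congr rfl fun y _ ↦ ?_
    simp only [LinearMap.smul_apply, ContinuousLinearMap.coe_coe, inner_smul_left,
      inner_smul_right, hker, Matrix.of_apply, smul_apply,
      one_apply_eq_self]
    simp
    ring
  rw [← h1, map_sub, inner_self_eq_norm_sq, inner_self_eq_norm_sq] at h
  rw [one_mul]
  exact le_of_sq_le_sq (by linarith) (norm_nonneg _)

/-- The operator `M_{z_j}` of multiplication by the `j`-th coordinate function on the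
Drury-Arveson space. It is built as the adjoint of the bounded operator
`k_d(·, z) v ↦ conj(z_j) k_d(·, z) v`; `mulCoord_apply` below shows that it is the multiplication
operator. -/
noncomputable def mulCoord (j : Fin d) : DruryArveson d Y →L[ℂ] DruryArveson d Y :=
  ContinuousLinearMap.adjoint ((kerSumShift d Y j).extendOfNorm (kerSum d Y))

/-- `(M_{z_j} f)(z) = z_j f(z)`, which determines `M_{z_j}`. -/
theorem mulCoord_apply (j : Fin d) (f : DruryArveson d Y) (z : UnitBall d) :
    mulCoord d Y j f z = z.1 j • f z := by
  refine ext_inner_left ℂ fun v ↦ ?_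
  have h := LinearMap.extendOfNorm_eq (f := kerSumShift d Y j) (denseRange_kerSum d Y)
    ⟨1, norm_kerSumShift_le d Y j⟩ (Finsupp.single z v)
  simp only [kerSum, kerSumShift, Finsupp.lsum_apply, Finsupp.sum_single_index, map_zero,
    LinearMap.smul_apply, ContinuousLinearMap.coe_coe] at h
  rw [← RKHS.kerFun_inner, mulCoord, ContinuousLinearMap.adjoint_inner_right]
  erw [h]
  simp [inner_smul_left, inner_smul_right]

end

end Kernels

section SchurClass

variable {d : ℕ} {U Y : Type*} [NormedAddCommGroup U] [InnerProductSpace ℂ U] [CompleteSpace U]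
  [NormedAddCommGroup Y] [InnerProductSpace ℂ Y] [CompleteSpace Y]

/-- The origin as a point of the ball. -/
def ballZero (d : ℕ) : UnitBall d := ⟨0, Metric.mem_ball_self one_pos⟩

/-- The de Branges-Rovnyak kernel `K_S(z, ζ) = (I_Y - S(z) S(ζ)^*) / (1 - ⟨z, ζ⟩)`. -/
noncomputable def schurKernel (S : UnitBall d → U →L[ℂ] Y) :
    Matrix (UnitBall d) (UnitBall d) (Y →L[ℂ] Y) :=
  Matrix.of fun z ζ ↦
    (1 - inner ℂ (ζ : EuclideanSpace ℂ (Fin d)) (z : EuclideanSpace ℂ (Fin d)))⁻¹ •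
      (ContinuousLinearMap.id ℂ Y - S z ∘L ContinuousLinearMap.adjoint (S ζ))

/-- The Schur class `S_d(U, Y)`: the kernel `K_S` is positive on the ball. -/
abbrev IsSchur (S : UnitBall d → U →L[ℂ] Y) : Prop :=
  (schurKernel S).PosSemidef

/-- The de Branges-Rovnyak space `H(K_S)`. -/
abbrev DBRSpace (S : UnitBall d → U →L[ℂ] Y) (hS : IsSchur S) : Type _ :=
  KernelSpace (schurKernel S) hS

/-- `S` is pure: `‖S(0) u‖ = ‖u‖` only for `u = 0`. -/
def IsPure (S : UnitBall d → U →L[ℂ] Y) : Prop :=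
  ∀ u : U, ‖S (ballZero d) u‖ = ‖u‖ → u = 0

/-- For `f, g ∈ H(K_S)`: the function `f` belongs to the Drury-Arveson space `H_Y(k_d)`, and
`g = M_{z_j}^* f`, the adjoint being taken in the metric of `H_Y(k_d)`. Since an element of a
reproducing kernel space is determined by its values, there is at most one such `g`. -/
def IsBackwardShift {S : UnitBall d → U →L[ℂ] Y} (hS : IsSchur S) (j : Fin d)
    (f g : DBRSpace S hS) : Prop :=
  ∃ F : DruryArveson d Y, (F : UnitBall d → Y) = f ∧
    (g : UnitBall d → Y) = ContinuousLinearMap.adjoint (mulCoord d Y j) F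

/-- `H(K_S)` is invariant under the backward shifts `M_{z_1}^*, …, M_{z_d}^*`: every function in
`H(K_S)` lies in `H_Y(k_d)`, and its backward shifts are again in `H(K_S)`. -/
def IsBackwardShiftInvariant {S : UnitBall d → U →L[ℂ] Y} (hS : IsSchur S) : Prop :=
  ∀ f : DBRSpace S hS, (∃ F : DruryArveson d Y, (F : UnitBall d → Y) = f) ∧
    ∀ j : Fin d, ∃ g : DBRSpace S hS, IsBackwardShift hS j f g

/-- The closed span `𝒟` in `H(K_S)^d` of the columns
`(conj(ζ_1) K_S(·, ζ) y, …, conj(ζ_d) K_S(·, ζ) y)`. -/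
noncomputable def colSpace {S : UnitBall d → U →L[ℂ] Y} (hS : IsSchur S) :
    Submodule ℂ (PiLp 2 fun _ : Fin d ↦ DBRSpace S hS) :=
  (Submodule.span ℂ {h | ∃ (ζ : UnitBall d) (y : Y), h = WithLp.toLp 2 fun j : Fin d ↦
    star ((ζ : EuclideanSpace ℂ (Fin d)) j) • RKHS.kerFun (DBRSpace S hS) ζ y}).topologicalClosure

/-- The space `{u ∈ U : S(z) u = 0 for all z}`. -/
noncomputable def nullInputs (S : UnitBall d → U →L[ℂ] Y) : Submodule ℂ U :=
  ⨅ z : UnitBall d, LinearMap.ker (S z : U →ₗ[ℂ] Y)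

end SchurClass

/-- The (orthogonal) dimension of a Hilbert space: the cardinality of an orthonormal basis. All
orthonormal bases have the same cardinality; the least one is taken. -/
noncomputable def hilbertDim (E : Type*) [NormedAddCommGroup E] [InnerProductSpace ℂ E] :
    Cardinal :=
  sInf {c | ∃ b : Set E, Orthonormal ℂ (fun x : b ↦ (x : E)) ∧
    (Submodule.span ℂ b).topologicalClosure = ⊤ ∧ Cardinal.mk b = c}

section Defect

variable {E F : Type*} [NormedAddCommGroup E] [InnerProductSpace ℂ E] [CompleteSpace E]
  [NormedAddCommGroup F] [InnerProductSpace ℂ F] [CompleteSpace F]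

/-- The defect operator `D_A = (I - A^* A)^{1/2}` of a contraction `A`. -/
noncomputable def defectOp (A : E →L[ℂ] F) : E →L[ℂ] E :=
  CFC.sqrt (ContinuousLinearMap.id ℂ E - ContinuousLinearMap.adjoint A ∘L A)

/-- The defect space of a contraction `A`, the closure of the range of `D_A`. -/
noncomputable def defectSpace (A : E →L[ℂ] F) : Submodule ℂ E :=
  (LinearMap.range (defectOp A : E →ₗ[ℂ] E)).topologicalClosure

theorem defectOp_mem (A : E →L[ℂ] F) (x : E) : defectOp A x ∈ defectSpace A :=
  Submodule.le_topologicalClosure _ (LinearMap.mem_range_self _ x)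

theorem defectOp_adjoint (A : E →L[ℂ] F) :
    ContinuousLinearMap.adjoint (defectOp A) = defectOp A :=
  (CFC.sqrt_nonneg (ContinuousLinearMap.id ℂ E - ContinuousLinearMap.adjoint A ∘L A)).isSelfAdjoint

theorem defectOp_sq {A : E →L[ℂ] F} (hA : ‖A‖ ≤ 1) :
    defectOp A ∘L defectOp A = ContinuousLinearMap.id ℂ E - ContinuousLinearMap.adjoint A ∘L A := by
  refine CFC.sqrt_mul_sqrt_self _ ?_
  rw [ContinuousLinearMap.nonneg_iff_isPositive, ContinuousLinearMap.isPositive_def']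
  refine ⟨?_, fun x ↦ ?_⟩
  · rw [ContinuousLinearMap.isSelfAdjoint_iff', map_sub, ContinuousLinearMap.adjoint_comp,
      ContinuousLinearMap.adjoint_adjoint, ContinuousLinearMap.adjoint_id]
  · have h : ‖A x‖ ≤ ‖x‖ := A.le_of_opNorm_le hA x |>.trans_eq (one_mul _)
    rw [ContinuousLinearMap.reApplyInnerSelf_apply]
    simp only [sub_apply, ContinuousLinearMap.id_apply, inner_sub_left,
      ContinuousLinearMap.comp_apply, ContinuousLinearMap.adjoint_inner_left, map_sub,
      inner_self_eq_norm_sq]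
    nlinarith [norm_nonneg (A x)]

/-- A contraction maps its defect space into the defect space of its adjoint. -/
theorem map_defectSpace {A : E →L[ℂ] F} (hA : ‖A‖ ≤ 1) {w : E} (hw : w ∈ defectSpace A) :
    A w ∈ defectSpace (ContinuousLinearMap.adjoint A) := by
  have hA' : ‖ContinuousLinearMap.adjoint A‖ ≤ 1 := by
    rwa [LinearIsometryEquiv.norm_map]
  have key : ∀ w : E, A (defectOp A w) ∈ defectSpace (ContinuousLinearMap.adjoint A) := by
    intro w
    rw [defectSpace, ← Submodule.orthogonal_orthogonal_eq_closure]
    intro x hx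
    have hx0 : defectOp (ContinuousLinearMap.adjoint A) x = 0 := by
      rw [← inner_self_eq_zero (𝕜 := ℂ), ← ContinuousLinearMap.adjoint_inner_right,
        defectOp_adjoint]
      rw [Submodule.mem_orthogonal'] at hx
      exact hx _ (LinearMap.mem_range_self _ _)
    have h1 := congrArg (fun B : F →L[ℂ] F ↦ B x) (defectOp_sq hA')
    simp only [ContinuousLinearMap.comp_apply, hx0, map_zero, sub_apply,
      ContinuousLinearMap.id_apply, ContinuousLinearMap.adjoint_adjoint] at h1
    have h2 := congrArg (fun B : E →L[ℂ] E ↦ B (ContinuousLinearMap.adjoint A x)) (defectOp_sq hA)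
    simp only [ContinuousLinearMap.comp_apply, sub_apply,
      ContinuousLinearMap.id_apply] at h2
    rw [← map_sub, ← h1, map_zero] at h2
    have h3 : defectOp A (ContinuousLinearMap.adjoint A x) = 0 := by
      rw [← inner_self_eq_zero (𝕜 := ℂ), ← ContinuousLinearMap.adjoint_inner_right,
        defectOp_adjoint, h2, inner_zero_right]
    rw [← ContinuousLinearMap.adjoint_inner_left, ← ContinuousLinearMap.adjoint_inner_left,
      defectOp_adjoint, h3, inner_zero_left]
  have hc : IsClosed {w : E | A w ∈ defectSpace (ContinuousLinearMap.adjoint A)} :=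
    (Submodule.isClosed_topologicalClosure _).preimage A.continuous
  refine closure_minimal ?_ hc hw
  rintro _ ⟨w, rfl⟩
  exact key w

end Defect

section RowContraction

variable {d : ℕ} {X : Type*} [NormedAddCommGroup X] [InnerProductSpace ℂ X]

/-- The block row operator `[T_1 ⋯ T_d] : X^d → X` of an operator tuple. -/
noncomputable def rowOp (T : Fin d → X →L[ℂ] X) : (PiLp 2 fun _ : Fin d ↦ X) →L[ℂ] X :=
  ∑ j, T j ∘L PiLp.proj 2 (fun _ : Fin d ↦ X) j

/-- `T` is a row contraction: `‖[T_1 ⋯ T_d]‖ ≤ 1`. -/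
def IsRowContraction (T : Fin d → X →L[ℂ] X) : Prop := ‖rowOp T‖ ≤ 1

/-- `T` is a commutative tuple. -/
def IsCommutative (T : Fin d → X →L[ℂ] X) : Prop := ∀ i j, T i ∘L T j = T j ∘L T i

/-- The compressions `P_M T_j|_M` of an operator tuple to a closed subspace `M`. -/
noncomputable def compressTuple (T : Fin d → X →L[ℂ] X) (M : Submodule ℂ X) [CompleteSpace M] :
    Fin d → M →L[ℂ] M :=
  fun j ↦ M.orthogonalProjectionOnto ∘L T j ∘L M.subtypeL

variable [CompleteSpace X]

/-- `T` is completely non-coisometric: there is no nonzero closed subspace `M`, invariant under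
all `T_j^*`, such that `P_M [T_1|_M ⋯ T_d|_M] : M^d → M` is a coisometry. -/
def IsCNC (T : Fin d → X →L[ℂ] X) : Prop :=
  ∀ (M : Submodule ℂ X) [CompleteSpace M],
    (∀ j, ∀ x ∈ M, ContinuousLinearMap.adjoint (T j) x ∈ M) →
    rowOp (compressTuple T M) ∘L ContinuousLinearMap.adjoint (rowOp (compressTuple T M)) =
      ContinuousLinearMap.id ℂ M →
    M = ⊥

/-- The block row `Z_X(z) = [z_1 I_X ⋯ z_d I_X]`. -/
noncomputable def rowZ (X : Type*) [NormedAddCommGroup X] [InnerProductSpace ℂ X]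
    (z : UnitBall d) : (PiLp 2 fun _ : Fin d ↦ X) →L[ℂ] X :=
  rowOp fun j ↦ (z : EuclideanSpace ℂ (Fin d)) j • ContinuousLinearMap.id ℂ X

/-- The operator `-T + D_{T^*} (I - Z(z) T^*)⁻¹ Z(z) D_T : X^d → X`. For a row contraction `T` and
`z` in the ball, `‖Z(z) T^*‖ < 1`, so that the inverse is the inverse of an invertible operator. -/
noncomputable def charFunOp (T : Fin d → X →L[ℂ] X) (z : UnitBall d) :
    (PiLp 2 fun _ : Fin d ↦ X) →L[ℂ] X :=
  -rowOp T + defectOp (ContinuousLinearMap.adjoint (rowOp T)) ∘L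
    Ring.inverse (ContinuousLinearMap.id ℂ X - rowZ X z ∘L ContinuousLinearMap.adjoint (rowOp T)) ∘L
      rowZ X z ∘L defectOp (rowOp T)

/-- The characteristic function `θ_T(z) : 𝒟_T → 𝒟_{T^*}` of a row contraction, the restriction of
`-T + D_{T^*} (I - Z(z) T^*)⁻¹ Z(z) D_T` to `𝒟_T`. -/
noncomputable def charFun (T : Fin d → X →L[ℂ] X) (hT : IsRowContraction T) (z : UnitBall d) :
    defectSpace (rowOp T) →L[ℂ] defectSpace (ContinuousLinearMap.adjoint (rowOp T)) :=
  (charFunOp T z ∘L (defectSpace (rowOp T)).subtypeL).codRestrict _ fun w ↦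
    Submodule.add_mem _ (Submodule.neg_mem _ (map_defectSpace hT w.2)) (defectOp_mem _ _)

/-- Coincidence of operator-valued functions on the ball: `S(z) = α θ(z) β` for all `z`, with
unitary operators `α` and `β` not depending on `z`. -/
def Coincide {U Y U' Y' : Type*} [NormedAddCommGroup U] [InnerProductSpace ℂ U]
    [NormedAddCommGroup Y] [InnerProductSpace ℂ Y] [NormedAddCommGroup U'] [InnerProductSpace ℂ U']
    [NormedAddCommGroup Y'] [InnerProductSpace ℂ Y']
    (S : UnitBall d → U →L[ℂ] Y) (θ : UnitBall d → U' →L[ℂ] Y') : Prop :=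
  ∃ (α : Y' ≃ₗᵢ[ℂ] Y) (β : U ≃ₗᵢ[ℂ] U'), ∀ z u, S z u = α (θ z (β u))

end RowContraction

end BallModel

universe u v w

namespace BallModel

open scoped InnerProductSpace
open ContinuousLinearMap (adjoint)

/-! ### Defect operators: intertwining and the Halmos dilation -/

section Operators

variable {E F : Type*} [NormedAddCommGroup E] [InnerProductSpace ℂ E] [CompleteSpace E]
  [NormedAddCommGroup F] [InnerProductSpace ℂ F] [CompleteSpace F]

/-! The space `DBRSpace S hS` is a copy of the state space of `T`, on which the backward shifts
become the operators `T_j^*`; all four claims are then read off from `T`.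

Write R(z) = (I - ∑ conj(z_j) T_j)⁻¹ D_{T^*}. The Halmos operator with rows (D_{T^*}, T) and (-T^*,
D_T) is isometric (`inner_halmos`), and applied to (y, Z(z)^* R(z) y) it yields (R(z) y, θ_T(z)^*
y). Hence I - θ_T(z) θ_T(ζ)^* agrees with (1 - ⟨z, ζ⟩) R(z)^* R(ζ) (`inner_adjoint_charFunOp`).
After the identifications α and β this says that K_S(·, ζ) y ↦ R(ζ) α⁻¹ y preserves inner products,
so it extends to an isometry V of H(K_S) into the state space.

The contractive inclusion J of H(K_S) in the Drury-Arveson space is adjoint to k_d(·, z) y ↦ K_S(·,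
z) y. The composite V J^* sends (I - ∑ conj(z_j) M_{z_j})⁻¹ y, with y a constant function, to (I - ∑
conj(z_j) T_j)⁻¹ D_{T^*} α⁻¹ y. Differentiation in z, with commutativity of both tuples, gives V J^*
M_{z_j} = T_j V J^* (`intertwine_of_inverse`, `comp_mulCoord_eq`). Therefore Ker V^* is invariant
under every T_j^*; it also lies in Ker D_{T^*}, so complete non-coisometry makes it zero and V is
unitary (`exists_model`).

Now A is T^* up to V, and f(0) = α D_{T^*} V f, so claim 3 even holds with equality. Purity follows
from θ_T(0) = -T. For the dimension count, β identifies the null inputs with the vectors of Ker T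
orthogonal to all Z(z)^* R(z) y, which is Ker A^* on 𝒟^⊥ seen through V
(`nonempty_nullInputs_equiv`). -/

theorem eq_zero_of_adjoint_comp_self {A : E →L[ℂ] F} (h : adjoint A ∘L A = 0) : A = 0 := by
  have := ContinuousLinearMap.norm_adjoint_comp_self A
  rw [h, norm_zero] at this
  exact norm_eq_zero.1 (mul_self_eq_zero.1 this.symm)

theorem eq_zero_of_comp_adjoint_self {A : E →L[ℂ] F} (h : A ∘L adjoint A = 0) : A = 0 := by
  have h1 : adjoint A = 0 := eq_zero_of_adjoint_comp_self (by
    rwa [ContinuousLinearMap.adjoint_adjoint])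
  rw [← ContinuousLinearMap.adjoint_adjoint A, h1, map_zero]

theorem adjoint_eq_of_nonneg {p : E →L[ℂ] E} (hp : 0 ≤ p) : adjoint p = p :=
  hp.isSelfAdjoint

/-- An operator intertwining the squares of two positive operators intertwines the operators. -/
theorem comp_eq_of_sq_comp_eq {p : E →L[ℂ] E} {q : F →L[ℂ] F} (hp : 0 ≤ p) (hq : 0 ≤ q)
    {B : F →L[ℂ] E} (h : p ∘L p ∘L B = B ∘L q ∘L q) : p ∘L B = B ∘L q := by
  have hpa := adjoint_eq_of_nonneg hp
  have hqa := adjoint_eq_of_nonneg hq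
  set W : F →L[ℂ] E := p ∘L B - B ∘L q with hW
  -- The difference `W` intertwines with the opposite sign, which will clash with positivity.
  have hpW : p ∘L W = -(W ∘L q) := by
    ext x
    have := DFunLike.congr_fun h x
    simp only [ContinuousLinearMap.comp_apply] at this
    simp [hW, this]
  have hWp : adjoint W ∘L p = -(q ∘L adjoint W) := by
    have := congrArg adjoint hpW
    simpa only [map_neg, ContinuousLinearMap.adjoint_comp, hpa, hqa] using this
  have hpC : p ∘L W ∘L adjoint W = -(W ∘L q ∘L adjoint W) := by
    ext x
    simpa using DFunLike.congr_fun hpW (adjoint W x)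
  have hCp : (W ∘L adjoint W) ∘L p = -(W ∘L q ∘L adjoint W) := by
    ext x
    simpa using congrArg W (DFunLike.congr_fun hWp x)
  have hC : 0 ≤ W ∘L adjoint W := by
    rw [ContinuousLinearMap.nonneg_iff_isPositive]
    exact ContinuousLinearMap.isPositive_self_comp_adjoint W
  -- A product of commuting positive operators is positive, while this one equals `-(W q W^*)`,
  -- which is negative; hence `W q W^* = 0`.
  have hcomm : Commute p (W ∘L adjoint W) := hpC.trans hCp.symm
  have h1 : 0 ≤ p * (W ∘L adjoint W) := (commute_iff_mul_nonneg hp hC).1 hcomm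
  have h2 : 0 ≤ W ∘L q ∘L adjoint W := by
    rw [ContinuousLinearMap.nonneg_iff_isPositive] at hq ⊢
    exact hq.conj_adjoint W
  have h3 : W ∘L q ∘L adjoint W = 0 := by
    refine le_antisymm ?_ h2
    have : p * (W ∘L adjoint W) = -(W ∘L q ∘L adjoint W) := hpC
    rw [this] at h1
    exact neg_nonneg.1 h1
  have h4 : W ∘L CFC.sqrt q = 0 := by
    refine eq_zero_of_comp_adjoint_self ?_
    have hs := CFC.sqrt_mul_sqrt_self q hq
    rw [ContinuousLinearMap.adjoint_comp, adjoint_eq_of_nonneg (CFC.sqrt_nonneg q), ← h3]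
    nth_rewrite 3 [← hs]
    rfl
  have h5 : W ∘L q = 0 := by
    nth_rewrite 1 [← CFC.sqrt_mul_sqrt_self q hq]
    change (W ∘L CFC.sqrt q) ∘L CFC.sqrt q = 0
    rw [h4, ContinuousLinearMap.zero_comp]
  -- Since `W q = 0` also gives `p W = 0`, only the term with `q` survives in `W^* W`, and a further
  -- factor `W` on its left annihilates it. So the square of `W^* W` vanishes.
  have h6 : adjoint W ∘L W = -(q ∘L adjoint B ∘L W) := by
    have : adjoint W = adjoint B ∘L p - q ∘L adjoint B := by
      rw [hW, map_sub, ContinuousLinearMap.adjoint_comp, ContinuousLinearMap.adjoint_comp, hpa, hqa]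
    rw [this]
    ext x
    have hx : p (W x) = 0 := by
      have := DFunLike.congr_fun hpW x
      rwa [h5, neg_zero] at this
    simp [hx]
  have h7 : adjoint W ∘L W = 0 := by
    refine eq_zero_of_adjoint_comp_self ?_
    rw [ContinuousLinearMap.adjoint_comp, ContinuousLinearMap.adjoint_adjoint]
    nth_rewrite 2 [h6]
    ext x
    simpa using congrArg (adjoint W) (DFunLike.congr_fun h5 (adjoint B (W x)))
  exact sub_eq_zero.1 (eq_zero_of_adjoint_comp_self h7)

theorem defectOp_nonneg (A : E →L[ℂ] F) : 0 ≤ defectOp A := CFC.sqrt_nonneg _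

/-- The intertwining relation `D_A A^* = A^* D_{A^*}`. -/
theorem defectOp_comp_adjoint {A : E →L[ℂ] F} (hA : ‖A‖ ≤ 1) :
    defectOp A ∘L adjoint A = adjoint A ∘L defectOp (adjoint A) := by
  refine comp_eq_of_sq_comp_eq (defectOp_nonneg A) (defectOp_nonneg _) ?_
  have hA' : ‖adjoint A‖ ≤ 1 := by rwa [LinearIsometryEquiv.norm_map]
  rw [defectOp_sq hA', ← ContinuousLinearMap.comp_assoc, defectOp_sq hA]
  ext x
  simp

theorem defectOp_apply_eq_self {A : E →L[ℂ] F} (hA : ‖A‖ ≤ 1) {w : E} (hw : A w = 0) :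
    defectOp A w = w := by
  have h2 : defectOp A (defectOp A w) = w := by
    have := DFunLike.congr_fun (defectOp_sq hA) w
    simpa [hw] using this
  have h3 := (ContinuousLinearMap.nonneg_iff_isPositive _).1 (defectOp_nonneg A)
  -- As `D² w = w`, the vector `D w - w` is an eigenvector of `D` with eigenvalue `-1`, which
  -- positivity forces to be zero.
  have h4 := h3.re_inner_nonneg_left (defectOp A w - w)
  rw [map_sub, h2, ← neg_sub, inner_neg_left, map_neg, inner_self_eq_norm_sq] at h4
  have h5 : ‖defectOp A w - w‖ = 0 := by nlinarith [norm_nonneg (defectOp A w - w)]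
  exact sub_eq_zero.1 (norm_eq_zero.1 h5)

theorem inner_defectOp_left (A : E →L[ℂ] F) (x y : E) :
    ⟪defectOp A x, y⟫_ℂ = ⟪x, defectOp A y⟫_ℂ := by
  rw [← ContinuousLinearMap.adjoint_inner_right, defectOp_adjoint]

theorem inner_defectOp_defectOp {A : E →L[ℂ] F} (hA : ‖A‖ ≤ 1) (x y : E) :
    ⟪defectOp A x, defectOp A y⟫_ℂ = ⟪x, y⟫_ℂ - ⟪A x, A y⟫_ℂ := by
  have := DFunLike.congr_fun (defectOp_sq hA) y
  simp only [ContinuousLinearMap.comp_apply] at this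
  rw [inner_defectOp_left, this]
  simp [ContinuousLinearMap.adjoint_inner_right]

/-- The Halmos dilation of a contraction preserves inner products. -/
theorem inner_halmos {A : E →L[ℂ] F} (hA : ‖A‖ ≤ 1) (y y' : F) (b b' : E) :
    ⟪defectOp (adjoint A) y + A b, defectOp (adjoint A) y' + A b'⟫_ℂ +
      ⟪-adjoint A y + defectOp A b, -adjoint A y' + defectOp A b'⟫_ℂ =
    ⟪y, y'⟫_ℂ + ⟪b, b'⟫_ℂ := by
  have hA' : ‖adjoint A‖ ≤ 1 := by rwa [LinearIsometryEquiv.norm_map]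
  have hc : ∀ x, defectOp A (adjoint A x) = adjoint A (defectOp (adjoint A) x) :=
    DFunLike.congr_fun (defectOp_comp_adjoint hA)
  have h1 : ⟪adjoint A y, defectOp A b'⟫_ℂ = ⟪defectOp (adjoint A) y, A b'⟫_ℂ := by
    rw [← inner_defectOp_left, hc, ContinuousLinearMap.adjoint_inner_left]
  have h2 : ⟪defectOp A b, adjoint A y'⟫_ℂ = ⟪A b, defectOp (adjoint A) y'⟫_ℂ := by
    rw [inner_defectOp_left, hc, ContinuousLinearMap.adjoint_inner_right]
  simp only [inner_add_left, inner_add_right, inner_neg_left, inner_neg_right,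
    inner_defectOp_defectOp hA, inner_defectOp_defectOp hA', h1, h2]
  ring

end Operators

/-! ### Operators defined on kernel functions -/

section KernelExtension

variable {P V H Z : Type*} [NormedAddCommGroup V] [InnerProductSpace ℂ V] [CompleteSpace V]
  [NormedAddCommGroup H] [InnerProductSpace ℂ H] [CompleteSpace H] [RKHS ℂ H P V]
  [NormedAddCommGroup Z] [InnerProductSpace ℂ Z]

/-- Continuous linear maps agreeing on the kernel functions agree. -/
theorem clm_ext_kerFun {A B : H →L[ℂ] Z}
    (h : ∀ x v, A (RKHS.kerFun H x v) = B (RKHS.kerFun H x v)) : A = B := by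
  refine ContinuousLinearMap.ext_on ((Submodule.dense_iff_topologicalClosure_eq_top).2
    (RKHS.kerFun_dense H)) ?_
  rintro _ ⟨x, v, rfl⟩
  exact h x v

variable [CompleteSpace Z]

/-- A map given on the kernel functions and bounded on their finite sums extends to a bounded
operator. -/
theorem exists_clm_kerFun (Γ : P → V →L[ℂ] Z)
    (h : ∀ v : P →₀ V, ‖v.sum fun x w ↦ Γ x w‖ ≤ ‖v.sum fun x w ↦ RKHS.kerFun H x w‖) :
    ∃ L : H →L[ℂ] Z, ∀ x v, L (RKHS.kerFun H x v) = Γ x v := by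
  let e : (P →₀ V) →ₗ[ℂ] H := Finsupp.lsum ℂ fun z ↦ (RKHS.kerFun H z : V →ₗ[ℂ] H)
  let f : (P →₀ V) →ₗ[ℂ] Z := Finsupp.lsum ℂ fun z ↦ (Γ z : V →ₗ[ℂ] Z)
  have hd : DenseRange e := by
    have hk := RKHS.kerFun_dense H
    rw [← Submodule.dense_iff_topologicalClosure_eq_top] at hk
    refine hk.mono ?_
    have : Submodule.span ℂ {RKHS.kerFun H x v | (x) (v)} ≤ LinearMap.range e := by
      rw [Submodule.span_le]
      rintro _ ⟨x, v, rfl⟩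
      exact ⟨Finsupp.single x v, by simp [e]⟩
    exact this
  refine ⟨f.extendOfNorm e, fun x v ↦ ?_⟩
  have := LinearMap.extendOfNorm_eq (f := f) hd ⟨1, fun v ↦ by rw [one_mul]; exact h v⟩
    (Finsupp.single x v)
  simpa [e, f] using this

/-- Equal Gram kernels give equal norms of finite sums, so the extension exists. The relation `L^* L
= 1` can then be tested on pairs of kernel functions. -/
theorem exists_isometry_kerFun (Γ : P → V →L[ℂ] Z)
    (h : ∀ x y v w, ⟪Γ x v, Γ y w⟫_ℂ = ⟪RKHS.kerFun H x v, RKHS.kerFun H y w⟫_ℂ) :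
    ∃ L : H →L[ℂ] Z, (∀ x v, L (RKHS.kerFun H x v) = Γ x v) ∧ adjoint L ∘L L = 1 := by
  obtain ⟨L, hL⟩ := exists_clm_kerFun (H := H) Γ fun v ↦ le_of_eq (by
    rw [← sq_eq_sq₀ (norm_nonneg _) (norm_nonneg _), ← Complex.ofReal_inj]
    push_cast
    simp_rw [← RCLike.ofReal_eq_complex_ofReal]
    rw [← inner_self_eq_norm_sq_to_K (𝕜 := ℂ), ← inner_self_eq_norm_sq_to_K (𝕜 := ℂ)]
    simp only [Finsupp.sum, sum_inner, inner_sum, h])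
  refine ⟨L, hL, clm_ext_kerFun fun x v ↦ RKHS.ext fun y ↦ ext_inner_left ℂ fun w ↦ ?_⟩
  rw [← RKHS.kerFun_inner, ← RKHS.kerFun_inner, ContinuousLinearMap.comp_apply,
    ContinuousLinearMap.adjoint_inner_right, hL, hL, h]
  rfl

end KernelExtension

/-! ### Intertwining commuting tuples through their resolvents -/

section Intertwining

/-- The linear combination `∑ c_j T_j` of an operator tuple. -/
noncomputable def tupleComb {d : ℕ} {A : Type*} [AddCommMonoid A] [Module ℂ A] (T : Fin d → A) :
    EuclideanSpace ℂ (Fin d) →ₗ[ℂ] A where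
  toFun c := ∑ j, c j • T j
  map_add' c c' := by simp [add_smul, Finset.sum_add_distrib]
  map_smul' a c := by simp [Finset.smul_sum, smul_smul]

theorem tupleComb_apply {d : ℕ} {A : Type*} [AddCommMonoid A] [Module ℂ A] (T : Fin d → A)
    (c : EuclideanSpace ℂ (Fin d)) : tupleComb T c = ∑ j, c j • T j := rfl

theorem tupleComb_single {d : ℕ} {A : Type*} [AddCommMonoid A] [Module ℂ A] (T : Fin d → A)
    (j : Fin d) : tupleComb T (EuclideanSpace.single j 1) = T j := by
  simp [tupleComb_apply]

theorem commute_tupleComb {d : ℕ} {A : Type*} [Ring A] [Algebra ℂ A] {T : Fin d → A}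
    (hT : ∀ i j, Commute (T i) (T j)) (c c' : EuclideanSpace ℂ (Fin d)) :
    Commute (tupleComb T c) (tupleComb T c') := by
  rw [tupleComb_apply, tupleComb_apply]
  exact Commute.sum_left _ _ _ fun i _ ↦ Commute.sum_right _ _ _ fun j _ ↦
    ((hT i j).smul_left _).smul_right _

theorem inverse_eq_add_mul {A : Type*} [Ring A] {a : A} (h : IsUnit (1 - a)) :
    Ring.inverse (1 - a) = 1 + a * Ring.inverse (1 - a) := by
  have := Ring.mul_inverse_cancel _ h
  rw [sub_mul, one_mul] at this
  exact sub_eq_iff_eq_add.1 this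

theorem commute_inverse_left {A : Type*} [Ring A] {a b : A} (ha : IsUnit a) (h : Commute a b) :
    Commute (Ring.inverse a) b := by
  obtain ⟨x, rfl⟩ := ha
  rw [Ring.inverse_unit]
  exact h.units_inv_left

variable {d : ℕ} {A : Type*} [NormedRing A] [NormedAlgebra ℂ A] [CompleteSpace A]

theorem isUnit_one_sub_tupleComb {T : Fin d → A}
    (hT : ∀ c, ‖tupleComb T c‖ ≤ ‖c‖) {c : EuclideanSpace ℂ (Fin d)} (hc : ‖c‖ < 1) :
    IsUnit (1 - tupleComb T c) :=
  isUnit_one_sub_of_norm_lt_one ((hT c).trans_lt hc)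

/-- The derivative of `s ↦ (1 - ∑ (c_j + s e_j) T_j)⁻¹`. -/
theorem hasDerivAt_inverse_one_sub_tupleComb {T : Fin d → A}
    (hT : ∀ c, ‖tupleComb T c‖ ≤ ‖c‖) {c : EuclideanSpace ℂ (Fin d)}
    (e : EuclideanSpace ℂ (Fin d)) {s : ℂ} (hc : ‖c + s • e‖ < 1) :
    HasDerivAt (fun s : ℂ ↦ Ring.inverse (1 - tupleComb T (c + s • e)))
      (Ring.inverse (1 - tupleComb T (c + s • e)) * tupleComb T e *
        Ring.inverse (1 - tupleComb T (c + s • e))) s := by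
  obtain ⟨x, hx⟩ := isUnit_one_sub_tupleComb hT hc
  have h1 : HasDerivAt (fun s : ℂ ↦ 1 - tupleComb T (c + s • e)) (-tupleComb T e) s := by
    have h2 : HasDerivAt (fun s : ℂ ↦ 1 - (tupleComb T c + s • tupleComb T e))
        (-((1 : ℂ) • tupleComb T e)) s :=
      (((hasDerivAt_id s).smul_const (tupleComb T e)).const_add _).const_sub _
    simpa only [map_add, map_smul, one_smul] using h2
  have h3 := hasFDerivAt_ringInverse (𝕜 := ℂ) x
  rw [hx] at h3
  have h4 := h3.comp_hasDerivAt s h1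
  rw [← hx]
  refine h4.congr_deriv ?_
  simp

variable {H K : Type*} [NormedAddCommGroup H] [NormedSpace ℂ H] [CompleteSpace H]
  [NormedAddCommGroup K] [NormedSpace ℂ K] [CompleteSpace K]

/-- Both sides of `hL` are differentiable in `c` on the open ball, so their derivatives in the
direction `e` agree. -/
theorem intertwine_deriv {M : Fin d → H →L[ℂ] H} {T : Fin d → K →L[ℂ] K}
    (hM : ∀ c, ‖tupleComb M c‖ ≤ ‖c‖) (hT : ∀ c, ‖tupleComb T c‖ ≤ ‖c‖)
    {L : H →L[ℂ] K} {g : H} {h : K}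
    (hL : ∀ c : EuclideanSpace ℂ (Fin d), ‖c‖ < 1 →
      L (Ring.inverse (1 - tupleComb M c) g) = Ring.inverse (1 - tupleComb T c) h)
    {c : EuclideanSpace ℂ (Fin d)} (hc : ‖c‖ < 1) (e : EuclideanSpace ℂ (Fin d)) :
    L ((Ring.inverse (1 - tupleComb M c) * tupleComb M e * Ring.inverse (1 - tupleComb M c)) g) =
      (Ring.inverse (1 - tupleComb T c) * tupleComb T e * Ring.inverse (1 - tupleComb T c)) h := by
  have hc0 : ‖c + (0 : ℂ) • e‖ < 1 := by simpa using hc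
  have h1 := hasDerivAt_inverse_one_sub_tupleComb hM e hc0
  have h2 := hasDerivAt_inverse_one_sub_tupleComb hT e hc0
  simp only [zero_smul, add_zero] at h1 h2
  have h3 := L.hasFDerivAt.comp_hasDerivAt (0 : ℂ) (h1.clm_apply (hasDerivAt_const (0 : ℂ) g))
  have h4 := h2.clm_apply (hasDerivAt_const (0 : ℂ) h)
  have hev : ∀ᶠ s : ℂ in nhds 0, ‖c + s • e‖ < 1 := by
    have : Continuous fun s : ℂ ↦ ‖c + s • e‖ := by fun_prop
    exact this.continuousAt.eventually_lt continuousAt_const hc0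
  have h5 := h3.congr_of_eventuallyEq (hev.mono fun s hs ↦ (hL _ hs).symm)
  simpa using h5.unique h4

/-- If `L (1 - ∑ c_j M_j)⁻¹ g = (1 - ∑ c_j T_j)⁻¹ h` on the ball for two commuting tuples, then `L`
intertwines the tuples on the vectors `(1 - ∑ c_j M_j)⁻¹ g`. -/
theorem intertwine_of_inverse {M : Fin d → H →L[ℂ] H} {T : Fin d → K →L[ℂ] K}
    (hM : ∀ c, ‖tupleComb M c‖ ≤ ‖c‖) (hT : ∀ c, ‖tupleComb T c‖ ≤ ‖c‖)
    (hMc : ∀ i j, Commute (M i) (M j)) (hTc : ∀ i j, Commute (T i) (T j))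
    {L : H →L[ℂ] K} {g : H} {h : K}
    (hL : ∀ c : EuclideanSpace ℂ (Fin d), ‖c‖ < 1 →
      L (Ring.inverse (1 - tupleComb M c) g) = Ring.inverse (1 - tupleComb T c) h)
    {c : EuclideanSpace ℂ (Fin d)} (hc : ‖c‖ < 1) (j : Fin d) :
    L (M j (Ring.inverse (1 - tupleComb M c) g)) =
      T j (L (Ring.inverse (1 - tupleComb M c) g)) := by
  set e : EuclideanSpace ℂ (Fin d) := EuclideanSpace.single j 1 with he
  have hMe : tupleComb M e = M j := tupleComb_single M j
  have hTe : tupleComb T e = T j := tupleComb_single T j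
  -- Differentiation first gives the relation on the squared resolvents: the direction `e` brings in
  -- `M j` and `T j`, while the direction `c`, together with `R² = R + R M_c R`, shows that `L`
  -- matches the squares themselves.
  have key : ∀ c : EuclideanSpace ℂ (Fin d), ‖c‖ < 1 →
      L (M j ((Ring.inverse (1 - tupleComb M c) * Ring.inverse (1 - tupleComb M c)) g)) =
      T j (L ((Ring.inverse (1 - tupleComb M c) * Ring.inverse (1 - tupleComb M c)) g)) := by
    intro c hc
    have h1 := intertwine_deriv hM hT hL hc e
    have h2 := intertwine_deriv hM hT hL hc c
    have h3 := hL c hc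
    have uM := isUnit_one_sub_tupleComb hM hc
    have uT := isUnit_one_sub_tupleComb hT hc
    have cM : ∀ e, Commute (Ring.inverse (1 - tupleComb M c)) (tupleComb M e) := fun e ↦
      commute_inverse_left uM ((Commute.one_left _).sub_left (commute_tupleComb hMc c e))
    have cT : ∀ e, Commute (Ring.inverse (1 - tupleComb T c)) (tupleComb T e) := fun e ↦
      commute_inverse_left uT ((Commute.one_left _).sub_left (commute_tupleComb hTc c e))
    have eM : Ring.inverse (1 - tupleComb M c) * Ring.inverse (1 - tupleComb M c) =
        Ring.inverse (1 - tupleComb M c) + Ring.inverse (1 - tupleComb M c) * tupleComb M c *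
          Ring.inverse (1 - tupleComb M c) := by
      nth_rewrite 2 [inverse_eq_add_mul uM]
      rw [mul_add, mul_one, mul_assoc]
    have eT : Ring.inverse (1 - tupleComb T c) * Ring.inverse (1 - tupleComb T c) =
        Ring.inverse (1 - tupleComb T c) + Ring.inverse (1 - tupleComb T c) * tupleComb T c *
          Ring.inverse (1 - tupleComb T c) := by
      nth_rewrite 2 [inverse_eq_add_mul uT]
      rw [mul_add, mul_one, mul_assoc]
    have h4 : L ((Ring.inverse (1 - tupleComb M c) * Ring.inverse (1 - tupleComb M c)) g) =
        (Ring.inverse (1 - tupleComb T c) * Ring.inverse (1 - tupleComb T c)) h := by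
      rw [eM, eT, add_apply, add_apply, map_add, h2, h3]
    rw [h4]
    rw [(cM e).eq, (cT e).eq, hMe, hTe, mul_assoc, mul_assoc] at h1
    exact h1
  set D : H →L[ℂ] K := L ∘L M j - T j ∘L L with hD
  -- To pass from squared resolvents to resolvents, note that `t R(tc)` has `t`-derivative `R(tc)²`,
  -- whose value at `g` is killed by `D`. So `φ` is constant along the segment, and it vanishes at
  -- `0`.
  let φ : ℂ → K := fun t ↦ D (t • Ring.inverse (1 - tupleComb M (t • c)) g)
  let s : Set ℂ := (fun t : ℂ ↦ t • c) ⁻¹' Metric.ball 0 1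
  have hs : IsOpen s := Metric.isOpen_ball.preimage (by fun_prop)
  have hs' : IsPreconnected s := by
    have : Convex ℝ s := (convex_ball (0 : EuclideanSpace ℂ (Fin d)) 1).is_linear_preimage
      (f := fun t : ℂ ↦ t • c) ⟨fun a b ↦ add_smul a b c, fun a b ↦ smul_assoc a b c⟩
    exact this.isPreconnected
  have hφ : ∀ t ∈ s, HasDerivAt φ 0 t := by
    intro t ht
    have ht' : ‖t • c‖ < 1 := by simpa [s] using ht
    have ht0 : ‖0 + t • c‖ < 1 := by rwa [zero_add]
    have h1 := hasDerivAt_inverse_one_sub_tupleComb hM c ht0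
    simp only [zero_add] at h1
    have h2 := (hasDerivAt_id t).smul (h1.clm_apply (hasDerivAt_const t g))
    have h3 := D.hasFDerivAt.comp_hasDerivAt t h2
    refine h3.congr_deriv ?_
    have uM := isUnit_one_sub_tupleComb hM ht'
    have eM : Ring.inverse (1 - tupleComb M (t • c)) * Ring.inverse (1 - tupleComb M (t • c)) =
        t • (Ring.inverse (1 - tupleComb M (t • c)) * tupleComb M c *
          Ring.inverse (1 - tupleComb M (t • c))) + Ring.inverse (1 - tupleComb M (t • c)) := by
      nth_rewrite 2 [inverse_eq_add_mul uM]
      rw [mul_add, mul_one, mul_assoc, add_comm, map_smul]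
      simp only [smul_mul_assoc, mul_smul_comm]
    have h5 := sub_eq_zero.2 (key _ ht')
    rw [eM] at h5
    simpa [hD] using h5
  have h0 : (0 : ℂ) ∈ s := by simp [s]
  have h1 : (1 : ℂ) ∈ s := by simpa [s] using hc
  have h2 : φ 1 = φ 0 := hs.is_const_of_deriv_eq_zero hs'
    (fun t ht ↦ (hφ t ht).differentiableAt.differentiableWithinAt)
    (fun t ht ↦ (hφ t ht).deriv) h1 h0
  have h3 : D (Ring.inverse (1 - tupleComb M c) g) = 0 := by
    simpa [φ] using h2
  exact sub_eq_zero.1 (by simpa [hD] using h3)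

end Intertwining

theorem re_inner_self {E : Type*} [NormedAddCommGroup E] [InnerProductSpace ℂ E] (v : E) :
    (⟪v, v⟫_ℂ).re = ‖v‖ ^ 2 :=
  inner_self_eq_norm_sq (𝕜 := ℂ) v

/-! ### Row contractions and conjugate points of the ball -/

section RowOperators

variable {d : ℕ} {X : Type*} [NormedAddCommGroup X] [InnerProductSpace ℂ X]

theorem rowOp_apply (T : Fin d → X →L[ℂ] X) (w : PiLp 2 fun _ : Fin d ↦ X) :
    rowOp T w = ∑ j, T j (w j) := by
  simp [rowOp, sum_apply]

/-- The combination sends `x` to the row operator applied to the column with entries `c j • x`,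
whose norm is `‖c‖ ‖x‖`. This makes `1 - ∑ c_j T_j` invertible on the open ball. -/
theorem norm_tupleComb_le {T : Fin d → X →L[ℂ] X} (hT : IsRowContraction T)
    (c : EuclideanSpace ℂ (Fin d)) : ‖tupleComb T c‖ ≤ ‖c‖ := by
  refine ContinuousLinearMap.opNorm_le_bound _ (norm_nonneg c) fun x ↦ ?_
  have h1 : tupleComb T c x = rowOp T (WithLp.toLp 2 fun j ↦ c j • x) := by
    simp [rowOp_apply, tupleComb_apply, sum_apply]
  have h2 : ‖(WithLp.toLp 2 fun j ↦ c j • x : PiLp 2 fun _ : Fin d ↦ X)‖ = ‖c‖ * ‖x‖ := by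
    rw [← sq_eq_sq₀ (norm_nonneg _) (by positivity), mul_pow, PiLp.norm_sq_eq_of_L2,
      EuclideanSpace.norm_sq_eq, Finset.sum_mul]
    simp [norm_smul, mul_pow]
  rw [h1, ← h2]
  exact ((rowOp T).le_of_opNorm_le hT _).trans_eq (one_mul _)

variable [CompleteSpace X]

theorem adjoint_rowOp_apply (T : Fin d → X →L[ℂ] X) (x : X) (j : Fin d) :
    adjoint (rowOp T) x j = adjoint (T j) x := by
  classical
  refine ext_inner_left ℂ fun v ↦ ?_
  have h1 : rowOp T (WithLp.toLp 2 (Pi.single j v)) = T j v := by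
    rw [rowOp_apply, Finset.sum_eq_single j]
    · simp
    · intro i _ hi
      simp [Pi.single_eq_of_ne hi]
    · simp
  have h2 := ContinuousLinearMap.adjoint_inner_right (rowOp T)
    (WithLp.toLp 2 (Pi.single j v)) x
  rw [h1, PiLp.inner_apply, Finset.sum_eq_single j] at h2
  · simpa [ContinuousLinearMap.adjoint_inner_right] using h2
  · intro i _ hi
    simp [Pi.single_eq_of_ne hi]
  · simp

theorem norm_sq_adjoint_rowOp (T : Fin d → X →L[ℂ] X) (x : X) :
    ‖adjoint (rowOp T) x‖ ^ 2 = ∑ j, ‖adjoint (T j) x‖ ^ 2 := by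
  rw [PiLp.norm_sq_eq_of_L2]
  simp only [adjoint_rowOp_apply]

theorem norm_sq_defectOp_adjoint {T : Fin d → X →L[ℂ] X} (hT : IsRowContraction T) (x : X) :
    ‖defectOp (adjoint (rowOp T)) x‖ ^ 2 = ‖x‖ ^ 2 - ∑ j, ‖adjoint (T j) x‖ ^ 2 := by
  have hA' : ‖adjoint (rowOp T)‖ ≤ 1 := by
    rw [LinearIsometryEquiv.norm_map]
    exact hT
  have h := congrArg Complex.re (inner_defectOp_defectOp hA' x x)
  rw [Complex.sub_re] at h
  rw [re_inner_self, re_inner_self, re_inner_self] at h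
  rw [h, norm_sq_adjoint_rowOp]

/-- The point of the ball with conjugate coordinates. -/
noncomputable def conjPoint (z : UnitBall d) : EuclideanSpace ℂ (Fin d) :=
  WithLp.toLp 2 fun j ↦ star (z.1 j)

theorem norm_conjPoint (z : UnitBall d) : ‖conjPoint z‖ = ‖(z : EuclideanSpace ℂ (Fin d))‖ := by
  simp [conjPoint, EuclideanSpace.norm_eq]

theorem norm_conjPoint_lt_one (z : UnitBall d) : ‖conjPoint z‖ < 1 := by
  rw [norm_conjPoint]
  exact mem_ball_zero_iff.1 z.2

theorem exists_conjPoint_eq {c : EuclideanSpace ℂ (Fin d)} (hc : ‖c‖ < 1) :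
    ∃ z : UnitBall d, conjPoint z = c := by
  refine ⟨⟨WithLp.toLp 2 fun j ↦ star (c j), ?_⟩, ?_⟩
  · rw [mem_ball_zero_iff]
    simpa [EuclideanSpace.norm_eq] using hc
  · ext j
    simp [conjPoint]

theorem conjPoint_ballZero : conjPoint (ballZero d) = 0 := by
  ext j
  simp [conjPoint, ballZero]

theorem adjoint_rowZ_apply (z : UnitBall d) (x : X) (j : Fin d) :
    adjoint (rowZ X z) x j = star (z.1 j) • x := by
  rw [rowZ, adjoint_rowOp_apply]
  refine ext_inner_left ℂ fun v ↦ ?_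
  rw [ContinuousLinearMap.adjoint_inner_right]
  simp [inner_smul_left, inner_smul_right]

theorem rowOp_adjoint_rowZ (T : Fin d → X →L[ℂ] X) (z : UnitBall d) (x : X) :
    rowOp T (adjoint (rowZ X z) x) = tupleComb T (conjPoint z) x := by
  simp [rowOp_apply, adjoint_rowZ_apply, tupleComb_apply, sum_apply, conjPoint]

theorem inner_adjoint_rowZ (z ζ : UnitBall d) (x y : X) :
    ⟪adjoint (rowZ X ζ) x, adjoint (rowZ X z) y⟫_ℂ =
      ⟪(z : EuclideanSpace ℂ (Fin d)), ζ⟫_ℂ * ⟪x, y⟫_ℂ := by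
  simp only [PiLp.inner_apply, adjoint_rowZ_apply, inner_smul_left, inner_smul_right,
    Finset.sum_mul]
  refine Finset.sum_congr rfl fun j _ ↦ ?_
  simp
  ring

end RowOperators

/-! ### The resolvent family of a row contraction -/

section ResolventFamily

variable {d : ℕ} {Y : Type*} [NormedAddCommGroup Y] [InnerProductSpace ℂ Y]
  {X : Type*} [NormedAddCommGroup X] [InnerProductSpace ℂ X]

/-- The operators `(I - ∑ conj(z_j) T_j)⁻¹ C`. -/
noncomputable def resolventFamily (T : Fin d → X →L[ℂ] X) (C : Y →L[ℂ] X) (z : UnitBall d) :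
    Y →L[ℂ] X :=
  Ring.inverse (1 - tupleComb T (conjPoint z)) ∘L C

theorem resolventFamily_ballZero (T : Fin d → X →L[ℂ] X) (C : Y →L[ℂ] X) :
    resolventFamily T C (ballZero d) = C := by
  ext y
  simp [resolventFamily, conjPoint_ballZero]

variable [CompleteSpace X]

theorem resolventFamily_sub {T : Fin d → X →L[ℂ] X} (hT : IsRowContraction T) (C : Y →L[ℂ] X)
    (z : UnitBall d) (y : Y) :
    resolventFamily T C z y - tupleComb T (conjPoint z) (resolventFamily T C z y) = C y := by
  have hu := isUnit_one_sub_tupleComb (norm_tupleComb_le hT) (norm_conjPoint_lt_one z)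
  exact DFunLike.congr_fun (Ring.mul_inverse_cancel _ hu) (C y)

end ResolventFamily

/-! ### The coordinate multipliers on the Drury-Arveson space -/

section DruryArvesonShift

variable {d : ℕ} {Y : Type*} [NormedAddCommGroup Y] [InnerProductSpace ℂ Y] [CompleteSpace Y]

theorem kerFun_druryArveson_apply (z ζ : UnitBall d) (y : Y) :
    RKHS.kerFun (DruryArveson d Y) ζ y z = daScalar d z ζ • y := by
  rw [RKHS.kerFun_apply, KernelSpace.kernel_eq]
  rfl

theorem one_sub_inner_ne_zero (z ζ : UnitBall d) :
    (1 - ⟪(ζ : EuclideanSpace ℂ (Fin d)), z⟫_ℂ) ≠ 0 := by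
  intro h
  have := norm_inner_lt_one z ζ
  rw [← sub_eq_zero.1 h] at this
  simp at this

theorem adjoint_mulCoord_kerFun (j : Fin d) (z : UnitBall d) (y : Y) :
    adjoint (mulCoord d Y j) (RKHS.kerFun (DruryArveson d Y) z y) =
      star (z.1 j) • RKHS.kerFun (DruryArveson d Y) z y := by
  refine ext_inner_right ℂ fun F ↦ ?_
  rw [ContinuousLinearMap.adjoint_inner_left, RKHS.kerFun_inner, mulCoord_apply, inner_smul_left,
    inner_smul_right, RKHS.kerFun_inner]
  simp

theorem commute_mulCoord (i j : Fin d) : Commute (mulCoord d Y i) (mulCoord d Y j) := by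
  refine ContinuousLinearMap.ext fun F ↦ RKHS.ext fun z ↦ ?_
  change mulCoord d Y i (mulCoord d Y j F) z = mulCoord d Y j (mulCoord d Y i F) z
  simp only [mulCoord_apply]
  exact smul_comm _ _ _

theorem tupleComb_mulCoord_apply (c : EuclideanSpace ℂ (Fin d)) (F : DruryArveson d Y)
    (z : UnitBall d) : tupleComb (mulCoord d Y) c F z = (∑ j, c j * z.1 j) • F z := by
  rw [← RKHS.adjoint_kerFun, tupleComb_apply, sum_apply, map_sum, Finset.sum_smul]
  refine Finset.sum_congr rfl fun j _ ↦ ?_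
  rw [RKHS.adjoint_kerFun, smul_apply, RKHS.coe_smul, Pi.smul_apply, mulCoord_apply, smul_smul]

theorem one_sub_tupleComb_mulCoord_kerFun (z : UnitBall d) (y : Y) :
    (1 - tupleComb (mulCoord d Y) (conjPoint z)) (RKHS.kerFun (DruryArveson d Y) z y) =
      RKHS.kerFun (DruryArveson d Y) (ballZero d) y := by
  refine RKHS.ext fun w ↦ ?_
  have h1 : ∑ j, conjPoint z j * w.1 j = ⟪(z : EuclideanSpace ℂ (Fin d)), w⟫_ℂ := by
    simp [conjPoint, PiLp.inner_apply, mul_comm]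
  rw [sub_apply, one_apply_eq_self, RKHS.coe_sub, Pi.sub_apply, tupleComb_mulCoord_apply, h1,
    kerFun_druryArveson_apply, kerFun_druryArveson_apply]
  nth_rewrite 1 [← one_smul ℂ (daScalar d w z • y)]
  rw [← sub_smul, smul_smul]
  congr 1
  simp only [daScalar, Matrix.of_apply]
  rw [mul_inv_cancel₀ (one_sub_inner_ne_zero w z)]
  simp [ballZero]

/-- Kernel functions are joint eigenvectors of the adjoints, so on them the sum is multiplication by
`⟨·, z⟩`, which changes `k_d(·, z) y` only by the constant function `y`. -/
theorem sum_mulCoord_adjoint (F : DruryArveson d Y) :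
    ∑ j, mulCoord d Y j (adjoint (mulCoord d Y j) F) =
      F - RKHS.kerFun (DruryArveson d Y) (ballZero d) (F (ballZero d)) := by
  let E₀ : DruryArveson d Y →L[ℂ] DruryArveson d Y :=
    RKHS.kerFun (DruryArveson d Y) (ballZero d) ∘L
      adjoint (RKHS.kerFun (DruryArveson d Y) (ballZero d))
  have h : ∑ j, mulCoord d Y j ∘L adjoint (mulCoord d Y j) = 1 - E₀ := by
    refine clm_ext_kerFun fun z y ↦ ?_
    have h1 := one_sub_tupleComb_mulCoord_kerFun z y
    rw [sub_apply, one_apply_eq_self, sub_eq_iff_eq_add, ← sub_eq_iff_eq_add'] at h1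
    have h2 : E₀ (RKHS.kerFun (DruryArveson d Y) z y) =
        RKHS.kerFun (DruryArveson d Y) (ballZero d) y := by
      simp only [E₀, ContinuousLinearMap.comp_apply, RKHS.adjoint_kerFun,
        kerFun_druryArveson_apply]
      simp [daScalar, ballZero]
    rw [sub_apply, one_apply_eq_self, h2, h1, tupleComb_apply, sum_apply, sum_apply]
    refine Finset.sum_congr rfl fun j _ ↦ ?_
    rw [ContinuousLinearMap.comp_apply, adjoint_mulCoord_kerFun, map_smul, smul_apply]
    rfl
  have := DFunLike.congr_fun h F
  simpa [sum_apply, E₀] using this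

theorem isRowContraction_mulCoord : IsRowContraction (mulCoord d Y) := by
  rw [IsRowContraction, ← LinearIsometryEquiv.norm_map (adjoint (𝕜 := ℂ)) (rowOp (mulCoord d Y))]
  refine ContinuousLinearMap.opNorm_le_bound _ zero_le_one fun F ↦ ?_
  rw [one_mul, ← sq_le_sq₀ (norm_nonneg _) (norm_nonneg _), norm_sq_adjoint_rowOp]
  -- Pairing the identity for `∑ M_{z_j} M_{z_j}^*` with `F` gives `∑ ‖M_{z_j}^* F‖² = ‖F‖² -
  -- ‖F(0)‖²`.
  have h := congrArg (fun G ↦ (⟪F, G⟫_ℂ).re) (sum_mulCoord_adjoint F)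
  simp only [inner_sum, inner_sub_right, Complex.re_sum, Complex.sub_re, RKHS.inner_kerFun] at h
  have e (j : Fin d) : (⟪F, mulCoord d Y j (adjoint (mulCoord d Y j) F)⟫_ℂ).re =
      ‖adjoint (mulCoord d Y j) F‖ ^ 2 := by
    rw [← ContinuousLinearMap.adjoint_inner_left, re_inner_self]
  simp only [e, re_inner_self] at h
  rw [h]
  linarith [sq_nonneg ‖F (ballZero d)‖]

/-- Kernel functions are thereby resolvents of the coordinate tuple applied to constants, the form
in which `intertwine_of_inverse` applies to them. -/
theorem kerFun_eq_inverse (z : UnitBall d) (y : Y) :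
    RKHS.kerFun (DruryArveson d Y) z y =
      Ring.inverse (1 - tupleComb (mulCoord d Y) (conjPoint z))
        (RKHS.kerFun (DruryArveson d Y) (ballZero d) y) := by
  have hu := isUnit_one_sub_tupleComb (norm_tupleComb_le (isRowContraction_mulCoord (Y := Y)))
    (norm_conjPoint_lt_one z)
  rw [← one_sub_tupleComb_mulCoord_kerFun z y, ← mul_apply_eq_comp,
    Ring.inverse_mul_cancel _ hu, one_apply_eq_self]

variable {X : Type*} [NormedAddCommGroup X] [InnerProductSpace ℂ X] [CompleteSpace X]

/-- An operator on the Drury-Arveson space given by a commuting row contraction `T` through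
`k_d(·, z) y ↦ (I - ∑ conj(z_j) T_j)⁻¹ C y` intertwines the coordinate multipliers with `T`. -/
theorem comp_mulCoord_eq {T : Fin d → X →L[ℂ] X} (hT : IsRowContraction T)
    (hcomm : IsCommutative T) {C : Y →L[ℂ] X} {L : DruryArveson d Y →L[ℂ] X}
    (hL : ∀ z y, L (RKHS.kerFun (DruryArveson d Y) z y) = resolventFamily T C z y) (j : Fin d) :
    L ∘L mulCoord d Y j = T j ∘L L := by
  refine clm_ext_kerFun fun z y ↦ ?_
  have h := intertwine_of_inverse (norm_tupleComb_le (isRowContraction_mulCoord (Y := Y)))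
    (norm_tupleComb_le hT) commute_mulCoord hcomm (L := L)
    (g := RKHS.kerFun (DruryArveson d Y) (ballZero d) y) (h := C y) (fun c hc ↦ by
      obtain ⟨w, rfl⟩ := exists_conjPoint_eq hc
      rw [← kerFun_eq_inverse, hL]
      rfl) (norm_conjPoint_lt_one z) j
  rwa [← kerFun_eq_inverse] at h

end DruryArvesonShift

/-! ### The characteristic function and its kernel factorization -/

section CharacteristicFunction

variable {d : ℕ} {X : Type*} [NormedAddCommGroup X] [InnerProductSpace ℂ X] [CompleteSpace X]

/-- The adjoint of `Z(z) T^*` is `T Z(z)^* = ∑ conj(z_j) T_j`, so the inverse turns into the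
resolvent of the tuple. -/
theorem adjoint_charFunOp_apply (T : Fin d → X →L[ℂ] X)
    (z : UnitBall d) (y : X) :
    adjoint (charFunOp T z) y = -adjoint (rowOp T) y + defectOp (rowOp T) (adjoint (rowZ X z)
      (resolventFamily T (defectOp (adjoint (rowOp T))) z y)) := by
  have hs : adjoint (ContinuousLinearMap.id ℂ X - rowZ X z ∘L adjoint (rowOp T)) =
      1 - tupleComb T (conjPoint z) := by
    rw [map_sub, ContinuousLinearMap.adjoint_comp, ContinuousLinearMap.adjoint_adjoint,
      ContinuousLinearMap.adjoint_id]
    ext x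
    simp [rowOp_adjoint_rowZ]
  have hi : adjoint (Ring.inverse (ContinuousLinearMap.id ℂ X - rowZ X z ∘L adjoint (rowOp T))) =
      Ring.inverse (1 - tupleComb T (conjPoint z)) := by
    rw [← hs]
    exact (Ring.inverse_star _).symm
  rw [charFunOp, map_add, map_neg, ContinuousLinearMap.adjoint_comp,
    ContinuousLinearMap.adjoint_comp, ContinuousLinearMap.adjoint_comp, hi, defectOp_adjoint,
    defectOp_adjoint]
  rfl

/-- The factorization of `I - θ_T(z) θ_T(ζ)^*`. -/
theorem inner_adjoint_charFunOp {T : Fin d → X →L[ℂ] X} (hT : IsRowContraction T)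
    (z ζ : UnitBall d) (y y' : X) :
    (1 - ⟪(z : EuclideanSpace ℂ (Fin d)), ζ⟫_ℂ) *
      ⟪resolventFamily T (defectOp (adjoint (rowOp T))) ζ y,
        resolventFamily T (defectOp (adjoint (rowOp T))) z y'⟫_ℂ =
    ⟪y, y'⟫_ℂ - ⟪adjoint (charFunOp T ζ) y, adjoint (charFunOp T z) y'⟫_ℂ := by
  -- With these second entries, the first Halmos component collapses to the resolvent vector by
  -- `resolventFamily_sub`, and the second is `θ_T^*` applied to `y` or `y'`.
  have h := inner_halmos hT y y'
    (adjoint (rowZ X ζ) (resolventFamily T (defectOp (adjoint (rowOp T))) ζ y))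
    (adjoint (rowZ X z) (resolventFamily T (defectOp (adjoint (rowOp T))) z y'))
  rw [← adjoint_charFunOp_apply T, ← adjoint_charFunOp_apply T, rowOp_adjoint_rowZ,
    rowOp_adjoint_rowZ, inner_adjoint_rowZ, ← resolventFamily_sub hT _ ζ y,
    ← resolventFamily_sub hT _ z y', sub_add_cancel, sub_add_cancel] at h
  linear_combination h

/-- Needed so that the adjoint on the full space, restricted to `𝒟_{T^*}`, is the adjoint of the
characteristic function between the defect spaces. -/
theorem adjoint_charFunOp_mem {T : Fin d → X →L[ℂ] X} (hT : IsRowContraction T)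
    (z : UnitBall d) {y : X} (hy : y ∈ defectSpace (adjoint (rowOp T))) :
    adjoint (charFunOp T z) y ∈ defectSpace (rowOp T) := by
  have hA' : ‖adjoint (rowOp T)‖ ≤ 1 := by
    rw [LinearIsometryEquiv.norm_map]
    exact hT
  rw [adjoint_charFunOp_apply T]
  refine Submodule.add_mem _ (Submodule.neg_mem _ ?_) (defectOp_mem _ _)
  simpa only [ContinuousLinearMap.adjoint_adjoint] using map_defectSpace hA' hy

end CharacteristicFunction

/-! ### Unitary invariance of the Hilbert space dimension -/

section HilbertDim

theorem exists_basis_image {E : Type*} {F : Type*}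
    [NormedAddCommGroup E] [InnerProductSpace ℂ E] [NormedAddCommGroup F] [InnerProductSpace ℂ F]
    (e : E ≃ₗᵢ[ℂ] F) {b : Set E} (hb : Orthonormal ℂ (fun x : b ↦ (x : E)))
    (hs : (Submodule.span ℂ b).topologicalClosure = ⊤) :
    Orthonormal ℂ (fun x : e '' b ↦ (x : F)) ∧
      (Submodule.span ℂ (e '' b)).topologicalClosure = ⊤ := by
  classical
  constructor
  · rw [orthonormal_subtype_iff_ite] at hb ⊢
    rintro _ ⟨x, hx, rfl⟩ _ ⟨y, hy, rfl⟩
    rw [e.inner_map_map, hb x hx y hy]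
    simp only [e.injective.eq_iff]
  · rw [← Submodule.dense_iff_topologicalClosure_eq_top] at hs ⊢
    have h := e.surjective.denseRange.dense_image e.continuous hs
    have hm : (Submodule.span ℂ (e '' b) : Set F) = e '' (Submodule.span ℂ b) := by
      have := Submodule.map_span (e.toLinearEquiv : E →ₗ[ℂ] F) b
      exact (congrArg (fun p : Submodule ℂ F ↦ (p : Set F)) this).symm
    rwa [hm]

/-- Isometrically isomorphic Hilbert spaces have the same dimension. -/
theorem lift_hilbertDim_eq.{a, b} {E : Type a} {F : Type b}
    [NormedAddCommGroup E] [InnerProductSpace ℂ E] [NormedAddCommGroup F] [InnerProductSpace ℂ F]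
    (e : E ≃ₗᵢ[ℂ] F) :
    Cardinal.lift.{b} (hilbertDim E) = Cardinal.lift.{a} (hilbertDim F) := by
  rw [hilbertDim, hilbertDim, Cardinal.lift_sInf, Cardinal.lift_sInf]
  congr 1
  ext c
  constructor
  · rintro ⟨_, ⟨s, h1, h2, rfl⟩, rfl⟩
    obtain ⟨h3, h4⟩ := exists_basis_image e h1 h2
    exact ⟨_, ⟨_, h3, h4, rfl⟩, Cardinal.mk_image_eq_lift e s e.injective⟩
  · rintro ⟨_, ⟨s, h1, h2, rfl⟩, rfl⟩
    obtain ⟨h3, h4⟩ := exists_basis_image e.symm h1 h2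
    exact ⟨_, ⟨_, h3, h4, rfl⟩, Cardinal.mk_image_eq_lift e.symm s e.symm.injective⟩

end HilbertDim

/-! ### Contractive inclusion in the Drury-Arveson space -/

section Inclusion

variable {d : ℕ} {U Y : Type*} [NormedAddCommGroup U] [InnerProductSpace ℂ U] [CompleteSpace U]
  [NormedAddCommGroup Y] [InnerProductSpace ℂ Y] [CompleteSpace Y]

theorem inner_kerFun_druryArveson (z ζ : UnitBall d) (y y' : Y) :
    ⟪RKHS.kerFun (DruryArveson d Y) ζ y, RKHS.kerFun (DruryArveson d Y) z y'⟫_ℂ =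
      (1 - ⟪(z : EuclideanSpace ℂ (Fin d)), ζ⟫_ℂ)⁻¹ * ⟪y, y'⟫_ℂ := by
  rw [RKHS.kerFun_inner, kerFun_druryArveson_apply, inner_smul_right]
  rfl

theorem inner_kerFun_dbrSpace {S : UnitBall d → U →L[ℂ] Y} (hS : IsSchur S) (z ζ : UnitBall d)
    (y y' : Y) :
    ⟪RKHS.kerFun (DBRSpace S hS) ζ y, RKHS.kerFun (DBRSpace S hS) z y'⟫_ℂ =
      (1 - ⟪(z : EuclideanSpace ℂ (Fin d)), ζ⟫_ℂ)⁻¹ *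
        (⟪y, y'⟫_ℂ - ⟪adjoint (S ζ) y, adjoint (S z) y'⟫_ℂ) := by
  rw [RKHS.kerFun_inner, RKHS.kerFun_apply, KernelSpace.kernel_eq]
  simp [schurKernel, inner_smul_right, inner_sub_right, ContinuousLinearMap.adjoint_inner_left]

/-- The adjoint of the contractive inclusion of `H(K_S)` into the Drury-Arveson space. -/
theorem exists_inclusion {S : UnitBall d → U →L[ℂ] Y} (hS : IsSchur S) :
    ∃ L : DruryArveson d Y →L[ℂ] DBRSpace S hS,
      (∀ z y, L (RKHS.kerFun (DruryArveson d Y) z y) = RKHS.kerFun (DBRSpace S hS) z y) ∧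
      ∀ f : DBRSpace S hS, (adjoint L f : UnitBall d → Y) = f := by
  obtain ⟨L, hL⟩ := exists_clm_kerFun (H := DruryArveson d Y) (RKHS.kerFun (DBRSpace S hS))
    fun v ↦ by
      -- The two squared norms differ by that of `∑ k_d(·, x) S(x)^* w` in the Drury-Arveson space
      -- over `U`, hence contractivity.
      have h : ⟪v.sum fun x w ↦ RKHS.kerFun (DBRSpace S hS) x w,
          v.sum fun x w ↦ RKHS.kerFun (DBRSpace S hS) x w⟫_ℂ =
          ⟪v.sum fun x w ↦ RKHS.kerFun (DruryArveson d Y) x w,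
            v.sum fun x w ↦ RKHS.kerFun (DruryArveson d Y) x w⟫_ℂ -
          ⟪v.sum fun x w ↦ RKHS.kerFun (DruryArveson d U) x (adjoint (S x) w),
            v.sum fun x w ↦ RKHS.kerFun (DruryArveson d U) x (adjoint (S x) w)⟫_ℂ := by
        simp only [Finsupp.sum, sum_inner, inner_sum, ← Finset.sum_sub_distrib,
          inner_kerFun_dbrSpace, inner_kerFun_druryArveson, mul_sub]
      have h' := congrArg Complex.re h
      rw [Complex.sub_re, re_inner_self, re_inner_self, re_inner_self] at h'
      rw [← sq_le_sq₀ (norm_nonneg _) (norm_nonneg _), h']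
      linarith [sq_nonneg ‖v.sum fun x w ↦ RKHS.kerFun (DruryArveson d U) x (adjoint (S x) w)‖]
  refine ⟨L, hL, fun f ↦ funext fun z ↦ ext_inner_left ℂ fun y ↦ ?_⟩
  rw [← RKHS.kerFun_inner, ContinuousLinearMap.adjoint_inner_right, hL, RKHS.kerFun_inner]

end Inclusion

theorem mem_defectSpace_orthogonal {E F : Type*} [NormedAddCommGroup E] [InnerProductSpace ℂ E]
    [CompleteSpace E] [NormedAddCommGroup F] [InnerProductSpace ℂ F] [CompleteSpace F]
    {A : E →L[ℂ] F} {x : E} (hx : defectOp A x = 0) : x ∈ (defectSpace A)ᗮ := by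
  rw [defectSpace, Submodule.orthogonal_closure, Submodule.mem_orthogonal]
  rintro _ ⟨y, rfl⟩
  change ⟪defectOp A y, x⟫_ℂ = 0
  rw [inner_defectOp_left, hx, inner_zero_right]

/-! ### Complete non-coisometry and vectors annihilated by the characteristic function -/

section Coisometric

variable {d : ℕ} {X : Type*} [NormedAddCommGroup X] [InnerProductSpace ℂ X] [CompleteSpace X]

/-- Invariance under `T_j^*` makes the projection superfluous in the adjoint of the compression. -/
theorem coe_adjoint_compressTuple (T : Fin d → X →L[ℂ] X) {M : Submodule ℂ X} [CompleteSpace M]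
    (hM : ∀ j, ∀ x ∈ M, adjoint (T j) x ∈ M) (j : Fin d) (x : M) :
    (adjoint (compressTuple T M j) x : X) = adjoint (T j) x := by
  have : adjoint (compressTuple T M j) x = ⟨adjoint (T j) x, hM j x x.2⟩ := by
    refine ext_inner_left ℂ fun v ↦ ?_
    rw [ContinuousLinearMap.adjoint_inner_right, Submodule.coe_inner, Submodule.coe_inner,
      ContinuousLinearMap.adjoint_inner_right, ← Submodule.coe_inner]
    exact M.inner_orthogonalProjectionOnto_eq_of_mem_right x (T j v)
  rw [this]

/-- A completely non-coisometric tuple has no nonzero closed subspace in the kernel of `D_{T^*}`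
that is invariant under the adjoints. -/
theorem IsCNC.eq_bot {T : Fin d → X →L[ℂ] X} (hT : IsRowContraction T) (hcnc : IsCNC T)
    {M : Submodule ℂ X} [CompleteSpace M] (hM : ∀ j, ∀ x ∈ M, adjoint (T j) x ∈ M)
    (hD : ∀ x ∈ M, defectOp (adjoint (rowOp T)) x = 0) : M = ⊥ := by
  refine hcnc M hM (ContinuousLinearMap.ext fun x ↦ Subtype.ext ?_)
  have hA' : ‖adjoint (rowOp T)‖ ≤ 1 := by
    rw [LinearIsometryEquiv.norm_map]
    exact hT
  have h1 := DFunLike.congr_fun (defectOp_sq hA') (x : X)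
  simp only [ContinuousLinearMap.comp_apply, hD x x.2, map_zero, sub_apply,
    ContinuousLinearMap.id_apply, ContinuousLinearMap.adjoint_adjoint] at h1
  have h2 : rowOp (compressTuple T M) (adjoint (rowOp (compressTuple T M)) x) =
      M.orthogonalProjectionOnto (rowOp T (adjoint (rowOp T) x)) := by
    simp only [rowOp_apply, adjoint_rowOp_apply, map_sum]
    refine Finset.sum_congr rfl fun j _ ↦ ?_
    rw [← coe_adjoint_compressTuple T hM]
    rfl
  rw [ContinuousLinearMap.comp_apply, h2, ← sub_eq_zero.1 h1.symm]
  simp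

theorem charFunOp_ballZero (T : Fin d → X →L[ℂ] X) : charFunOp T (ballZero d) = -rowOp T := by
  have : rowZ X (ballZero d) = 0 := by
    ext w
    simp [rowZ, rowOp_apply, ballZero]
  simp [charFunOp, this]

/-- The vectors annihilated by the characteristic function. -/
theorem charFunOp_eq_zero_iff {T : Fin d → X →L[ℂ] X} (hT : IsRowContraction T)
    {w : PiLp 2 fun _ : Fin d ↦ X} (hw : w ∈ defectSpace (rowOp T)) :
    (∀ z, charFunOp T z w = 0) ↔ rowOp T w = 0 ∧
      ∀ z, ∀ y ∈ defectSpace (adjoint (rowOp T)), ⟪w, adjoint (rowZ X z)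
        (resolventFamily T (defectOp (adjoint (rowOp T))) z y)⟫_ℂ = 0 := by
  -- If `T w = 0`, then the term `-T^* y` contributes nothing and `D_T w = w`, so the defect
  -- operator disappears from the pairing.
  have key (h : rowOp T w = 0) (z : UnitBall d) (y : X) : ⟪charFunOp T z w, y⟫_ℂ =
      ⟪w, adjoint (rowZ X z) (resolventFamily T (defectOp (adjoint (rowOp T))) z y)⟫_ℂ := by
    rw [← ContinuousLinearMap.adjoint_inner_right, adjoint_charFunOp_apply, inner_add_right,
      inner_neg_right, ContinuousLinearMap.adjoint_inner_right, h, inner_zero_left, neg_zero,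
      zero_add, ← inner_defectOp_left, defectOp_apply_eq_self hT h]
  constructor
  · intro h
    have h0 : rowOp T w = 0 := by
      have := h (ballZero d)
      rwa [charFunOp_ballZero, neg_apply, neg_eq_zero] at this
    exact ⟨h0, fun z y _ ↦ by rw [← key h0, h z, inner_zero_left]⟩
  · rintro ⟨h0, h⟩ z
    -- Testing against `𝒟_{T^*}` suffices because `θ_T(z) w` itself lies there.
    have hm : charFunOp T z w ∈ defectSpace (adjoint (rowOp T)) :=
      (charFun T hT z ⟨w, hw⟩).2
    rw [← inner_self_eq_zero (𝕜 := ℂ), key h0, h z _ hm]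

end Coisometric

/-! ### The functional model and the dimension count -/

section Model

variable {d : ℕ} {U Y X : Type*} [NormedAddCommGroup U] [InnerProductSpace ℂ U]
  [NormedAddCommGroup Y] [InnerProductSpace ℂ Y]
  [NormedAddCommGroup X] [InnerProductSpace ℂ X] [CompleteSpace X]
  {S : UnitBall d → U →L[ℂ] Y} {T : Fin d → X →L[ℂ] X} {hT : IsRowContraction T}
  {α : defectSpace (adjoint (rowOp T)) ≃ₗᵢ[ℂ] Y} {β : U ≃ₗᵢ[ℂ] defectSpace (rowOp T)}

variable (α) in
/-- The operator `D_{T^*} α^{-1}`. -/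
noncomputable def outputOp : Y →L[ℂ] X :=
  defectOp (adjoint (rowOp T)) ∘L (defectSpace (adjoint (rowOp T))).subtypeL ∘L
    (α.symm.toContinuousLinearEquiv : Y →L[ℂ] _)

theorem resolventFamily_outputOp (z : UnitBall d) (y : Y) :
    resolventFamily T (outputOp α) z y =
      resolventFamily T (defectOp (adjoint (rowOp T))) z (α.symm y) := rfl

/-- Since `θ_T(0) = -T`, a vector whose norm is preserved is killed by `D_T`; lying also in `𝒟_T`,
it is orthogonal to itself. -/
theorem isPure_of_coincide (hST : ∀ z u, S z u = α (charFun T hT z (β u))) : IsPure S := by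
  intro u hu
  rw [hST, α.norm_map, ← β.norm_map] at hu
  have h1 : ‖rowOp T (β u)‖ = ‖(β u : PiLp 2 fun _ : Fin d ↦ X)‖ := by
    have h2 : ((charFun T hT (ballZero d) (β u) : defectSpace (adjoint (rowOp T))) : X) =
        -rowOp T (β u) := by
      change charFunOp T (ballZero d) (β u) = _
      rw [charFunOp_ballZero, neg_apply]
    rw [← norm_neg, ← h2]
    exact hu
  have h2 : defectOp (rowOp T) (β u) = 0 := by
    have h := congrArg Complex.re (inner_defectOp_defectOp hT (β u) (β u))
    rw [Complex.sub_re, re_inner_self, re_inner_self, re_inner_self, h1, sub_self] at h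
    exact norm_eq_zero.1 (pow_eq_zero_iff two_ne_zero |>.1 h)
  have h3 := mem_defectSpace_orthogonal h2
  have h4 : (β u : PiLp 2 fun _ : Fin d ↦ X) = 0 :=
    inner_self_eq_zero.1 (Submodule.inner_right_of_mem_orthogonal (β u).2 h3)
  exact β.map_eq_zero_iff.1 (Subtype.ext h4)

theorem mem_nullInputs_iff (hST : ∀ z u, S z u = α (charFun T hT z (β u))) (u : U) :
    u ∈ nullInputs S ↔ rowOp T (β u) = 0 ∧
      ∀ z, ∀ y ∈ defectSpace (adjoint (rowOp T)), ⟪(β u : PiLp 2 fun _ : Fin d ↦ X),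
        adjoint (rowZ X z) (resolventFamily T (defectOp (adjoint (rowOp T))) z y)⟫_ℂ = 0 := by
  rw [← charFunOp_eq_zero_iff hT (β u).2, nullInputs, Submodule.mem_iInf]
  refine forall_congr' fun z ↦ ?_
  rw [LinearMap.mem_ker]
  change S z u = 0 ↔ _
  rw [hST, α.map_eq_zero_iff, ← Submodule.coe_eq_zero]
  rfl

variable [CompleteSpace U] [CompleteSpace Y]

theorem coe_adjoint_eq_of_coincide (hST : ∀ z u, S z u = α (charFun T hT z (β u)))
    (z : UnitBall d) (y : Y) :
    (β (adjoint (S z) y) : PiLp 2 fun _ : Fin d ↦ X) = adjoint (charFunOp T z) (α.symm y) := by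
  have : β (adjoint (S z) y) =
      ⟨adjoint (charFunOp T z) (α.symm y), adjoint_charFunOp_mem hT z (α.symm y).2⟩ := by
    refine ext_inner_left ℂ fun v ↦ ?_
    obtain ⟨u, rfl⟩ := β.surjective v
    rw [β.inner_map_map, ContinuousLinearMap.adjoint_inner_right, hST, Submodule.coe_inner,
      ContinuousLinearMap.adjoint_inner_right]
    nth_rewrite 1 [← α.apply_symm_apply y]
    rw [α.inner_map_map]
    rfl
  rw [this]

theorem inner_resolventFamily_eq (hST : ∀ z u, S z u = α (charFun T hT z (β u))) (hS : IsSchur S)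
    (z ζ : UnitBall d) (y y' : Y) :
    ⟪resolventFamily T (outputOp α) ζ y, resolventFamily T (outputOp α) z y'⟫_ℂ =
      ⟪RKHS.kerFun (DBRSpace S hS) ζ y, RKHS.kerFun (DBRSpace S hS) z y'⟫_ℂ := by
  have h := inner_adjoint_charFunOp hT z ζ (α.symm y) (α.symm y')
  rw [← coe_adjoint_eq_of_coincide hST, ← coe_adjoint_eq_of_coincide hST, ← Submodule.coe_inner,
    ← Submodule.coe_inner, β.inner_map_map, α.symm.inner_map_map] at h
  rw [inner_kerFun_dbrSpace, ← h, inv_mul_cancel_left₀ (one_sub_inner_ne_zero ζ z)]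
  rfl

/-- The functional model: `H(K_S)` is unitarily equivalent to the state space of `T`, and the
backward shifts correspond to the operators `T_j^*`. -/
theorem exists_model (hST : ∀ z u, S z u = α (charFun T hT z (β u))) (hS : IsSchur S)
    (hcomm : IsCommutative T) (hcnc : IsCNC T) :
    ∃ (V : DBRSpace S hS ≃ₗᵢ[ℂ] X) (J : DBRSpace S hS →L[ℂ] DruryArveson d Y),
      (∀ z y, V (RKHS.kerFun (DBRSpace S hS) z y) = resolventFamily T (outputOp α) z y) ∧
      (∀ f, (J f : UnitBall d → Y) = f) ∧
      ∀ j f, adjoint (mulCoord d Y j) (J f) = J (V.symm (adjoint (T j) (V f))) := by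
  obtain ⟨L, hL, hJ⟩ := exists_inclusion hS
  obtain ⟨V, hV, hVV⟩ := exists_isometry_kerFun (H := DBRSpace S hS)
    (resolventFamily T (outputOp α)) fun x y v w ↦ inner_resolventFamily_eq hST hS y x v w
  have hint (j : Fin d) : (V ∘L L) ∘L mulCoord d Y j = T j ∘L V ∘L L :=
    comp_mulCoord_eq hT hcomm (fun z y ↦ by rw [ContinuousLinearMap.comp_apply, hL, hV]) j
  have hadj (j : Fin d) (x : X) : adjoint (mulCoord d Y j) (adjoint L (adjoint V x)) =
      adjoint L (adjoint V (adjoint (T j) x)) := by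
    have := DFunLike.congr_fun (congrArg adjoint (hint j)) x
    simpa only [ContinuousLinearMap.adjoint_comp, ContinuousLinearMap.comp_apply] using this
  have hJinj {f : DBRSpace S hS} (hf : adjoint L f = 0) : f = 0 := by
    refine DFunLike.coe_injective ?_
    rw [← hJ f, hf, RKHS.coe_zero, RKHS.coe_zero]
  -- Invariance of `Ker V^*` under `T_j^*` comes from the intertwining and the injectivity of the
  -- inclusion.
  have hbot : LinearMap.ker (adjoint V : X →ₗ[ℂ] DBRSpace S hS) = ⊥ := by
    have : CompleteSpace (LinearMap.ker (adjoint V : X →ₗ[ℂ] DBRSpace S hS)) :=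
      (adjoint V).isClosed_ker.completeSpace_coe
    refine hcnc.eq_bot hT (fun j x hx ↦ ?_) fun x hx ↦ ?_
    · have hx' : adjoint V x = 0 := hx
      refine LinearMap.mem_ker.2 (hJinj ?_)
      change adjoint L (adjoint V (adjoint (T j) x)) = 0
      rw [← hadj, hx', map_zero, map_zero]
    · have hx' : adjoint V x = 0 := hx
      -- The choice `y = α D_{T^*} x` at the origin, where the resolvent is the identity, turns the
      -- pairing into `‖D_{T^*} x‖²`.
      have h1 := ContinuousLinearMap.adjoint_inner_left V
        (RKHS.kerFun (DBRSpace S hS) (ballZero d) (α ⟨_, defectOp_mem _ x⟩)) x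
      rw [hx', inner_zero_left, hV, resolventFamily_ballZero] at h1
      simp only [outputOp, ContinuousLinearMap.comp_apply] at h1
      rw [← inner_defectOp_left] at h1
      refine (inner_self_eq_zero (𝕜 := ℂ)).1 (Eq.trans ?_ h1.symm)
      simp
  have hsurj (x : X) : V (adjoint V x) = x := by
    have : V (adjoint V x) - x ∈ LinearMap.ker (adjoint V : X →ₗ[ℂ] DBRSpace S hS) := by
      have := DFunLike.congr_fun hVV (adjoint V x)
      simp only [ContinuousLinearMap.comp_apply, one_apply_eq_self] at this
      simp [this]
    rw [hbot, Submodule.mem_bot, sub_eq_zero] at this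
    exact this
  have hVi (f g : DBRSpace S hS) : ⟪V f, V g⟫_ℂ = ⟪f, g⟫_ℂ := by
    rw [← ContinuousLinearMap.adjoint_inner_right, ← ContinuousLinearMap.comp_apply, hVV,
      one_apply_eq_self]
  let W : DBRSpace S hS ≃ₗᵢ[ℂ] X := LinearIsometryEquiv.ofSurjective
    ((V : DBRSpace S hS →ₗ[ℂ] X).isometryOfInner hVi) fun x ↦ ⟨adjoint V x, hsurj x⟩
  have hW (f) : W f = V f := rfl
  have hWs (x : X) : W.symm x = adjoint V x := by
    rw [LinearIsometryEquiv.symm_apply_eq, hW, hsurj]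
  refine ⟨W, adjoint L, hV, hJ, fun j f ↦ ?_⟩
  rw [hWs, ← hadj, ← hWs, W.symm_apply_apply]

/-- A function in the Drury-Arveson space is determined by its values, so the witness in
`IsBackwardShift` can only be `J f`. -/
theorem isBackwardShift_iff {hS : IsSchur S} {V : DBRSpace S hS ≃ₗᵢ[ℂ] X}
    {J : DBRSpace S hS →L[ℂ] DruryArveson d Y} (hJ : ∀ f, (J f : UnitBall d → Y) = f)
    (hV : ∀ j f, adjoint (mulCoord d Y j) (J f) = J (V.symm (adjoint (T j) (V f))))
    (j : Fin d) (f g : DBRSpace S hS) :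
    IsBackwardShift hS j f g ↔ g = V.symm (adjoint (T j) (V f)) := by
  constructor
  · rintro ⟨F, hF, hg⟩
    have hFJ : F = J f := DFunLike.coe_injective (hF.trans (hJ f).symm)
    refine DFunLike.coe_injective ?_
    rw [hg, hFJ, hV, hJ]
  · rintro rfl
    exact ⟨J f, hJ f, by rw [hV, hJ]⟩

/-- Evaluation at the origin is the adjoint of the kernel function there, which `V` carries to
`D_{T^*} α⁻¹ y`; hence `f(0) = α D_{T^*} V f`. -/
theorem norm_apply_ballZero {hS : IsSchur S} {V : DBRSpace S hS ≃ₗᵢ[ℂ] X}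
    (hV : ∀ z y, V (RKHS.kerFun (DBRSpace S hS) z y) = resolventFamily T (outputOp α) z y)
    (f : DBRSpace S hS) :
    ‖f (ballZero d)‖ = ‖defectOp (adjoint (rowOp T)) (V f)‖ := by
  have h : f (ballZero d) = α ⟨_, defectOp_mem _ (V f)⟩ := by
    refine ext_inner_left ℂ fun y ↦ ?_
    rw [← RKHS.kerFun_inner, ← V.inner_map_map, hV, resolventFamily_ballZero]
    nth_rewrite 2 [← α.apply_symm_apply y]
    rw [α.inner_map_map]
    exact inner_defectOp_left _ _ _
  rw [h, α.norm_map]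
  rfl

/-- The block column of the operators `V⁻¹ T_j^* V`. -/
noncomputable def modelCol (T : Fin d → X →L[ℂ] X) {H : Type*} [NormedAddCommGroup H]
    [InnerProductSpace ℂ H] (V : H ≃ₗᵢ[ℂ] X) : H →L[ℂ] PiLp 2 fun _ : Fin d ↦ H :=
  ((LinearIsometryEquiv.piLpCongrRight 2 fun _ : Fin d ↦ V).symm.toContinuousLinearEquiv :
      (PiLp 2 fun _ : Fin d ↦ X) →L[ℂ] PiLp 2 fun _ : Fin d ↦ H) ∘L
    adjoint (rowOp T) ∘L (V.toContinuousLinearEquiv : H →L[ℂ] X)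

theorem modelCol_apply {H : Type*} [NormedAddCommGroup H] [InnerProductSpace ℂ H]
    (V : H ≃ₗᵢ[ℂ] X) (f : H) (j : Fin d) :
    modelCol T V f j = V.symm (adjoint (T j) (V f)) := by
  rw [← adjoint_rowOp_apply]
  rfl

theorem adjoint_modelCol_apply {H : Type*} [NormedAddCommGroup H] [InnerProductSpace ℂ H]
    [CompleteSpace H] (V : H ≃ₗᵢ[ℂ] X) (w : PiLp 2 fun _ : Fin d ↦ X) :
    adjoint (modelCol T V) ((LinearIsometryEquiv.piLpCongrRight 2 fun _ : Fin d ↦ V).symm w) =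
      V.symm (rowOp T w) := by
  refine ext_inner_left ℂ fun f ↦ ?_
  rw [ContinuousLinearMap.adjoint_inner_right, ← V.inner_map_map f, V.apply_symm_apply,
    ← ContinuousLinearMap.adjoint_inner_left]
  exact (LinearIsometryEquiv.piLpCongrRight 2 fun _ : Fin d ↦ V).symm.inner_map_map
    (adjoint (rowOp T) (V f)) w

/-- Entrywise `V` carries the generators of `𝒟` to `Z(z)^* R(z) α⁻¹ y`, and `α⁻¹` reaches every
vector of `𝒟_{T^*}`. -/
theorem mem_colSpace_orthogonal_iff {hS : IsSchur S} {V : DBRSpace S hS ≃ₗᵢ[ℂ] X}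
    (hV : ∀ z y, V (RKHS.kerFun (DBRSpace S hS) z y) = resolventFamily T (outputOp α) z y)
    (w : PiLp 2 fun _ : Fin d ↦ X) :
    (LinearIsometryEquiv.piLpCongrRight 2 fun _ : Fin d ↦ V).symm w ∈ (colSpace hS)ᗮ ↔
      ∀ z, ∀ y ∈ defectSpace (adjoint (rowOp T)), ⟪w, adjoint (rowZ X z)
        (resolventFamily T (defectOp (adjoint (rowOp T))) z y)⟫_ℂ = 0 := by
  set Φ := LinearIsometryEquiv.piLpCongrRight 2 fun _ : Fin d ↦ V with hΦ
  have key (z : UnitBall d) (y : Y) : Φ (WithLp.toLp 2 fun j : Fin d ↦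
      star ((z : EuclideanSpace ℂ (Fin d)) j) • RKHS.kerFun (DBRSpace S hS) z y) =
      adjoint (rowZ X z) (resolventFamily T (defectOp (adjoint (rowOp T))) z (α.symm y)) := by
    ext j
    rw [adjoint_rowZ_apply, ← resolventFamily_outputOp, ← hV]
    simp [hΦ]
  rw [colSpace, Submodule.orthogonal_closure, Submodule.mem_orthogonal']
  constructor
  · intro h z y hy
    have := h _ (Submodule.subset_span ⟨z, α ⟨y, hy⟩, rfl⟩)
    rw [← Φ.inner_map_map, Φ.apply_symm_apply, key, α.symm_apply_apply] at this
    exact this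
  · intro h u hu
    induction hu using Submodule.span_induction with
    | mem u hu =>
      obtain ⟨z, y, rfl⟩ := hu
      rw [← Φ.inner_map_map, Φ.apply_symm_apply, key]
      exact h z _ (α.symm y).2
    | zero => exact inner_zero_right _
    | add u v _ _ hu hv => rw [inner_add_right, hu, hv, add_zero]
    | smul a u _ hu => rw [inner_smul_right, hu, mul_zero]

/-- The kernel of `A^*` on `𝒟^⊥` is unitarily equivalent to the space of null inputs. -/
theorem nonempty_nullInputs_equiv (hST : ∀ z u, S z u = α (charFun T hT z (β u)))
    {hS : IsSchur S} {V : DBRSpace S hS ≃ₗᵢ[ℂ] X}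
    (hV : ∀ z y, V (RKHS.kerFun (DBRSpace S hS) z y) = resolventFamily T (outputOp α) z y) :
    Nonempty (nullInputs S ≃ₗᵢ[ℂ]
      LinearMap.ker ((adjoint (modelCol T V) ∘L (colSpace hS)ᗮ.subtypeL :
        (colSpace hS)ᗮ →L[ℂ] DBRSpace S hS) : (colSpace hS)ᗮ →ₗ[ℂ] DBRSpace S hS)) := by
  set Φ := LinearIsometryEquiv.piLpCongrRight 2 fun _ : Fin d ↦ V with hΦ
  let Ψ : U →ₗᵢ[ℂ] PiLp 2 fun _ : Fin d ↦ DBRSpace S hS :=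
    Φ.symm.toLinearIsometry.comp
      ((defectSpace (rowOp T)).subtypeₗᵢ.comp β.toLinearIsometry)
  have hΨ (u : U) : Ψ u = Φ.symm (β u) := rfl
  have h1 (u : nullInputs S) : Ψ u ∈ (colSpace hS)ᗮ :=
    (mem_colSpace_orthogonal_iff hV _).2 ((mem_nullInputs_iff hST u).1 u.2).2
  have h2 (u : nullInputs S) : adjoint (modelCol T V) (Ψ u) = 0 := by
    rw [hΨ, adjoint_modelCol_apply, ((mem_nullInputs_iff hST u).1 u.2).1, map_zero]
  let Λ : nullInputs S →ₗᵢ[ℂ]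
      LinearMap.ker ((adjoint (modelCol T V) ∘L (colSpace hS)ᗮ.subtypeL :
        (colSpace hS)ᗮ →L[ℂ] DBRSpace S hS) : (colSpace hS)ᗮ →ₗ[ℂ] DBRSpace S hS) :=
    { toFun := fun u ↦ ⟨⟨Ψ u, h1 u⟩, h2 u⟩
      map_add' := fun u v ↦ Subtype.ext (Subtype.ext (map_add Ψ (u : U) v))
      map_smul' := fun a u ↦ Subtype.ext (Subtype.ext (map_smul Ψ a (u : U)))
      norm_map' := fun u ↦ Ψ.norm_map u }
  refine ⟨LinearIsometryEquiv.ofSurjective Λ ?_⟩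
  rintro ⟨⟨w, hw1⟩, hw2⟩
  obtain ⟨x, rfl⟩ := Φ.symm.surjective w
  have hx0 : rowOp T x = 0 := by
    have h : adjoint (modelCol T V) (Φ.symm x) = 0 := hw2
    rwa [adjoint_modelCol_apply, V.symm.map_eq_zero_iff] at h
  -- Surjectivity rests on this: `D_T` fixes every vector of `Ker T`, so `Ker T` lies in `𝒟_T`, the
  -- range of `β`.
  have hx1 : x ∈ defectSpace (rowOp T) := by
    rw [← defectOp_apply_eq_self hT hx0]
    exact defectOp_mem _ _
  have hβ : (β (β.symm ⟨x, hx1⟩) : PiLp 2 fun _ : Fin d ↦ X) = x := by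
    rw [β.apply_symm_apply]
  refine ⟨⟨β.symm ⟨x, hx1⟩, (mem_nullInputs_iff hST _).2 ?_⟩, ?_⟩
  · rw [hβ]
    exact ⟨hx0, (mem_colSpace_orthogonal_iff hV x).1 hw1⟩
  · refine Subtype.ext (Subtype.ext ?_)
    change Φ.symm (β (β.symm ⟨x, hx1⟩) : PiLp 2 fun _ : Fin d ↦ X) = Φ.symm x
    rw [hβ]

end Model

end BallModel


theorem theorem5p6 {d : ℕ}
    {U : Type u} [NormedAddCommGroup U] [InnerProductSpace ℂ U] [CompleteSpace U]
    {Y : Type v} [NormedAddCommGroup Y] [InnerProductSpace ℂ Y] [CompleteSpace Y]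
    {X : Type w} [NormedAddCommGroup X] [InnerProductSpace ℂ X] [CompleteSpace X]
    (S : BallModel.UnitBall d → U →L[ℂ] Y) (hS : BallModel.IsSchur S)
    (T : Fin d → X →L[ℂ] X) (hT : BallModel.IsRowContraction T)
    (hcomm : BallModel.IsCommutative T) (hcnc : BallModel.IsCNC T)
    (hST : BallModel.Coincide S (BallModel.charFun T hT)) :
    BallModel.IsPure S ∧
    BallModel.IsBackwardShiftInvariant hS ∧
    (∀ (f : BallModel.DBRSpace S hS) (g : Fin d → BallModel.DBRSpace S hS),
      (∀ j, BallModel.IsBackwardShift hS j f (g j)) →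
      ∑ j, ‖g j‖ ^ 2 ≤ ‖f‖ ^ 2 - ‖f (BallModel.ballZero d)‖ ^ 2) ∧
    -- the block column `A` of the restricted backward shifts, which is determined by its entries
    ∃ A : BallModel.DBRSpace S hS →L[ℂ] PiLp 2 fun _ : Fin d ↦ BallModel.DBRSpace S hS,
      (∀ f j, BallModel.IsBackwardShift hS j f (A f j)) ∧
      Cardinal.lift.{u} (BallModel.hilbertDim
        (LinearMap.ker ((ContinuousLinearMap.adjoint A ∘L (BallModel.colSpace hS)ᗮ.subtypeL :
          (BallModel.colSpace hS)ᗮ →L[ℂ] BallModel.DBRSpace S hS) :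
          (BallModel.colSpace hS)ᗮ →ₗ[ℂ] BallModel.DBRSpace S hS))) =
      Cardinal.lift.{v} (BallModel.hilbertDim (BallModel.nullInputs S)) := by
  obtain ⟨α, β, hST⟩ := hST
  obtain ⟨V, J, hV, hJ, hVT⟩ := BallModel.exists_model hST hS hcomm hcnc
  have hbs := BallModel.isBackwardShift_iff hJ hVT
  refine ⟨BallModel.isPure_of_coincide hST,
    fun f ↦ ⟨⟨J f, hJ f⟩, fun j ↦ ⟨_, (hbs j f _).2 rfl⟩⟩, fun f g hg ↦ ?_,
    BallModel.modelCol T V, fun f j ↦ (hbs j f _).2 (BallModel.modelCol_apply V f j), ?_⟩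
  -- `‖f(0)‖² = ‖D_{T^*} V f‖² = ‖V f‖² - ∑ ‖T_j^* V f‖²`, so the inequality is in fact an equality.
  · rw [BallModel.norm_apply_ballZero hV, BallModel.norm_sq_defectOp_adjoint hT, V.norm_map,
      sub_sub_cancel]
    refine le_of_eq (Finset.sum_congr rfl fun j _ ↦ ?_)
    rw [(hbs j f _).1 (hg j), V.symm.norm_map]
  · obtain ⟨e⟩ := BallModel.nonempty_nullInputs_equiv hST hV
    exact (BallModel.lift_hilbertDim_eq e).symm
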